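/- Let $m \ge 0$ be an integer, let $\mathfrak{h}$ be the Cartan subalgebra of diagonal matrices in $\mathfrak{sl}_m(\mathbb{C})$, let $e_i \in \mathfrak{h}^*$ send a diagonal matrix to its $i$-th diagonal entry, and let $\Lambda \subset \mathfrak{h}^*$ be the integral weight lattice. For $\lambda \in \Lambda$, let $\mathrm{M}(\lambda)$ be the Verma module of highest weight $\lambda$ with respect to the upper triangular Borel subalgebra, that is, the quotient of $U(\mathfrak{sl}_m(\mathbb{C}))$ by the left ideal generated by the strictly upper triangular matrices and the elements $h-\lambda(h)$, $h \in \mathfrak{h}$. Write $\mathrm{M}(\lambda)_\mu$ for its weight spaces, and define the shifted character \[ \underline{\mathrm{ch}}_\lambda(x_1,\ldots,x_m)=\sum_{\mu \in \Lambda} \dim \mathrm{M}(\lambda)_\mu \, x^{\mu-\lambda}, \] where, for $\nu \in \mathbb{Z}^m$ with $\sum_i \nu_i = 0$, the weight $\sum_i \nu_i e_i$ is identified with the exponent vector $\nu$. For a Laurent generating function, set \[ \mathrm{N}\Big(\sum_{\alpha \in \mathbb{Z}^m} c_\alpha x^\alpha\Big)=\sum_{\alpha \in \mathbb{N}^m}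 c_\alpha \frac{x^\alpha}{\alpha_1!\cdots\alpha_m!}. \] A real polynomial $h$ in $m$ variables, homogeneous of degree $d$, is Lorentzian if its coefficients are nonnegative, its support $\mathrm{J} \subseteq \mathbb{N}^m$ is $\mathrm{M}$-convex (for all $\alpha,\beta \in \mathrm{J}$ and $i$ with $\alpha_i > \beta_i$ there is $j$ with $\alpha_j<\beta_j$ such that $\alpha-\epsilon_i+\epsilon_j \in \mathrm{J}$ and $\beta-\epsilon_j+\epsilon_i \in \mathrm{J}$, where $\epsilon_i$ are the standard basis vectors), and, if $d\ge 2$, every partial derivative of $h$ of order $d-2$ is a quadratic form with at most one positive eigenvalue. Then, for every $\lambda \in \Lambda$: \begin{enumerate} \item for every $\mu \in \Lambda$, the weight space $\mathrm{M}(\lambda)_\mu$ is finite-dimensional, and it is zero unless $\mu-\lambda = \sum_i \nu_i e_i$ for some $\nu \in \mathbb{Z}^m$ with $\sum_i \nu_i=0$; \item $\underline{\mathrm{ch}}_\lambda=\prod_{i>j}(1+x_ix_j^{-1}+x_i^2x_j^{-2}+\cdots)$, that is, the coefficient of $x^\nu$ in $\underline{\mathrm{ch}}_\lambda$ is the number of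 families $(k_{ij})_{i>j}$ of nonnegative integers with $\sum_{i>j} k_{ij}(\epsilon_i-\epsilon_j)=\nu$; \item for every $\delta \in \mathbb{N}^m$, $\mathrm{N}(x^\delta\, \underline{\mathrm{ch}}_\lambda)$ is a polynomial, and it is Lorentzian. \end{enumerate} -/

import Mathlib

open MvPolynomial

noncomputable section

namespace VermaLorentzian

/-! ### Lorentzian polynomials -/

/-- A set `J` of integral vectors is `M`-convex: for any index `i` and `α, β ∈ J` with `α i > β i`,
there is an index `j` with `α j < β j`, `α - e_i + e_j ∈ J` and `β - e_j + e_i ∈ J`. -/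
def MConvex {σ : Type*} [DecidableEq σ] (J : Set (σ → ℤ)) : Prop :=
  ∀ (i : σ), ∀ α ∈ J, ∀ β ∈ J, β i < α i →
    ∃ j : σ, α j < β j ∧
      α - Pi.single i 1 + Pi.single j 1 ∈ J ∧ β - Pi.single j 1 + Pi.single i 1 ∈ J

/-- The set of exponents of the monomials appearing in `h`, as a set of integral vectors. -/
def expSupport {σ : Type*} (h : MvPolynomial σ ℝ) : Set (σ → ℤ) :=
  {α | ∃ a ∈ h.support, ∀ i, α i = (a i : ℤ)}

/-- The iterated partial derivative `∂/∂x_{i₁} ⋯ ∂/∂x_{iₖ} h` for the list `[i₁, …, iₖ]`. -/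
def iterPDeriv {σ : Type*} (s : List σ) (h : MvPolynomial σ ℝ) : MvPolynomial σ ℝ :=
  s.foldr (fun i q => pderiv i q) h

/-- The matrix of second partial derivatives at the origin. When `q` is a quadratic form this is
the (constant) Hessian matrix of `q`, that is, twice the symmetric matrix of `q`. -/
def hessian {σ : Type*} (q : MvPolynomial σ ℝ) : Matrix σ σ ℝ :=
  Matrix.of fun i j => constantCoeff (pderiv i (pderiv j q))

theorem pderiv_pderiv_swap {σ : Type*} (i j : σ) (q : MvPolynomial σ ℝ) :
    pderiv i (pderiv j q) = pderiv j (pderiv i q) := by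
  classical
  have h : ⁅(pderiv i : Derivation ℝ (MvPolynomial σ ℝ) (MvPolynomial σ ℝ)),
      (pderiv j : Derivation ℝ (MvPolynomial σ ℝ) (MvPolynomial σ ℝ))⁆ = 0 := by
    refine MvPolynomial.derivation_ext (R := ℝ) fun k => ?_
    rw [Derivation.commutator_apply, pderiv_X, pderiv_X]
    simp only [Pi.single_apply]
    split_ifs <;> simp
  have h2 := congrArg (fun D : Derivation ℝ (MvPolynomial σ ℝ) (MvPolynomial σ ℝ) => D q) h
  simp only [Derivation.commutator_apply, Derivation.zero_apply] at h2
  exact sub_eq_zero.mp h2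

theorem hessian_isHermitian {σ : Type*} (q : MvPolynomial σ ℝ) : (hessian q).IsHermitian := by
  ext i j
  simp only [hessian, Matrix.conjTranspose_apply, Matrix.of_apply, star_trivial]
  rw [pderiv_pderiv_swap]

/-- The quadratic form `q` has at most one positive eigenvalue (counted with multiplicity). -/
def AtMostOnePosEigenvalue {σ : Type*} [Fintype σ] [DecidableEq σ] (q : MvPolynomial σ ℝ) : Prop :=
  (Finset.univ.filter fun i => 0 < (hessian_isHermitian q).eigenvalues i).card ≤ 1

/-- Lorentzian polynomials: homogeneous of some degree `d`, with nonnegative coefficients and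
`M`-convex support, all of whose partial derivatives of order `d - 2` have at most one positive
eigenvalue (no such condition when `d < 2`). -/
def IsLorentzian {σ : Type*} [Fintype σ] [DecidableEq σ] (h : MvPolynomial σ ℝ) : Prop :=
  ∃ d : ℕ, h.IsHomogeneous d ∧
    (∀ a, 0 ≤ h.coeff a) ∧
    MConvex (expSupport h) ∧
    ∀ s : List σ, s.length + 2 = d → AtMostOnePosEigenvalue (iterPDeriv s h)

/-! ### Laurent generating functions -/

/-- A Laurent generating function `∑_{α ∈ ℤ^σ} c_α x^α`, given by its coefficients `c`. -/
abbrev LaurentGF (σ : Type*) := (σ → ℤ) → ℝ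

/-- Multiplication by the monomial `x^δ`. -/
def LaurentGF.monomialMul {σ : Type*} (δ : σ → ℕ) (c : LaurentGF σ) : LaurentGF σ :=
  fun α => c (fun i => α i - (δ i : ℤ))

/-- The normalization `N (∑_{α ∈ ℤ^σ} c_α x^α) = ∑_{α ∈ ℕ^σ} c_α x^α / α!`. -/
def LaurentGF.normalize {σ : Type*} [Fintype σ] (c : LaurentGF σ) : MvPowerSeries σ ℝ :=
  fun a => c (fun i => (a i : ℤ)) / ∏ i, (Nat.factorial (a i) : ℝ)

/-- The expansion of `∏_{i > j} (1 + x_i x_j⁻¹ + x_i² x_j⁻² + ⋯)`: the coefficient of `x^ν` is the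
number of families of exponents `(k_{ij})_{i > j}` with `∏_{i > j} (x_i x_j⁻¹)^{k_{ij}} = x^ν`. -/
def geometricProduct (m : ℕ) : LaurentGF (Fin m) := fun ν =>
  (Nat.card {k : {p : Fin m × Fin m // p.2 < p.1} → ℕ //
    ∑ p, k p • (Pi.single p.1.1 1 - Pi.single p.1.2 1 : Fin m → ℤ) = ν} : ℝ)

/-! ### Verma modules of `sl_m(ℂ)` -/

/-- The Lie algebra `sl_m(ℂ)`. -/
abbrev SL (m : ℕ) := LieAlgebra.SpecialLinear.sl (Fin m) ℂ

/-- The Cartan subalgebra of diagonal matrices in `sl_m(ℂ)`. -/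
def cartan (m : ℕ) : Submodule ℂ (SL m) where
  carrier := {x | x.val.IsDiag}
  add_mem' hx hy := by
    intro i j hij
    simp [hx hij, hy hij]
  zero_mem' := by
    intro i j _
    simp
  smul_mem' c x hx := by
    intro i j hij
    simp [hx hij]

/-- The element `E_ii - E_jj` of the Cartan subalgebra. -/
def coroot (m : ℕ) (i j : Fin m) : cartan m :=
  ⟨LieAlgebra.SpecialLinear.singleSubSingle i j 1, by
    intro a b hab
    simp only [LieAlgebra.SpecialLinear.val_singleSubSingle, Matrix.sub_apply, Matrix.single_apply]
    rw [if_neg (fun h => hab (h.1.symm.trans h.2)), if_neg (fun h => hab (h.1.symm.trans h.2)),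
      sub_zero]⟩

/-- The integral weight lattice `Λ`: the linear forms on the Cartan subalgebra that take integral
values on all coroots. -/
def weightLattice (m : ℕ) : AddSubgroup (Module.Dual ℂ (cartan m)) where
  carrier := {μ | ∀ i j : Fin m, ∃ n : ℤ, μ (coroot m i j) = (n : ℂ)}
  add_mem' hx hy := by
    intro i j
    obtain ⟨a, ha⟩ := hx i j
    obtain ⟨b, hb⟩ := hy i j
    exact ⟨a + b, by simp [ha, hb]⟩
  zero_mem' := fun i j => ⟨0, by simp⟩
  neg_mem' hx := by
    intro i j
    obtain ⟨a, ha⟩ := hx i j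
    exact ⟨-a, by simp [ha]⟩

/-- The weight `∑ ν_i e_i`, where `e_i` sends a diagonal matrix to its `i`-th diagonal entry. -/
def weightOf {m : ℕ} (ν : Fin m → ℤ) : Module.Dual ℂ (cartan m) where
  toFun h := ∑ i, (ν i : ℂ) * h.val.val i i
  map_add' x y := by
    simp [mul_add, Finset.sum_add_distrib]
  map_smul' c x := by
    simp only [RingHom.id_apply, smul_eq_mul, Finset.mul_sum]
    refine Finset.sum_congr rfl fun i _ => ?_
    have h : (c • x).val.val i i = c * x.val.val i i := rfl
    rw [h]
    ring

/-- The universal enveloping algebra of `sl_m(ℂ)`. -/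
abbrev U (m : ℕ) := UniversalEnvelopingAlgebra ℂ (SL m)

/-- The image in the enveloping algebra of an element of `sl_m(ℂ)`. -/
def toU {m : ℕ} (x : SL m) : U m := UniversalEnvelopingAlgebra.ι ℂ x

/-- The left ideal of the enveloping algebra generated by the strictly upper triangular matrices
(the positive root vectors) and by the elements `h - λ(h)` for `h` in the Cartan subalgebra. -/
def vermaIdeal {m : ℕ} (lam : Module.Dual ℂ (cartan m)) : Submodule (U m) (U m) :=
  Submodule.span (U m)
    ({u | ∃ x : SL m, (∀ i j : Fin m, j ≤ i → x.val i j = 0) ∧ u = toU x} ∪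
     {u | ∃ h : cartan m, u = toU h.val - algebraMap ℂ (U m) (lam h)})

/-- The Verma module `M(λ)`, the universal highest weight module of highest weight `λ`. -/
abbrev Verma {m : ℕ} (lam : Module.Dual ℂ (cartan m)) := U m ⧸ vermaIdeal lam

/-- The weight space `M(λ)_μ`. -/
def weightSpace {m : ℕ} (lam μ : Module.Dual ℂ (cartan m)) : Submodule ℂ (Verma lam) where
  carrier := {v | ∀ h : cartan m, toU h.val • v = μ h • v}
  add_mem' hx hy := fun h => by rw [smul_add, smul_add, hx h, hy h]
  zero_mem' := fun h => by rw [smul_zero, smul_zero]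
  smul_mem' c x hx := fun h => by
    rw [smul_comm (toU h.val) c x, hx h, smul_comm]

open Classical in
/-- The shifted character `∑_{μ ∈ Λ} dim M(λ)_μ x^{μ - λ}`. A weight `μ - λ` in the root lattice is
`∑ ν_i e_i` for exactly one `ν ∈ ℤ^m` with `∑ ν_i = 0`, and `x^{μ - λ}` is the monomial `x^ν` for
that `ν`; so the coefficient of `x^ν` vanishes unless `ν` has degree zero. -/
def shiftedCharacter {m : ℕ} (lam : Module.Dual ℂ (cartan m)) : LaurentGF (Fin m) := fun ν =>
  if ∑ i, ν i = 0 then (Module.finrank ℂ (weightSpace lam (lam + weightOf ν)) : ℝ) else 0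

end VermaLorentzian

end

/-! Lorentzian side. Dividing coefficients by `α!` turns differentiation into a shift
(`IsEGF.pderiv`), so the Hessians to be tested are matrices `(c (γ + ε_i + ε_j))` of values of a
shift `c` of Kostant's partition function. All such matrices satisfy the reversed Cauchy–Schwarz
inequality. Indeed the partition function arises from the delta sequence at the origin by summing
translates along one negative root after another. For a strictly positive sequence such a sum
preserves the inequality: consecutive translates share a row, and the resulting estimates telescope
(`isLorentzForm_sum_of_linked`, `IsLorentzSeq.window`). The delta sequence is not positive, so it is
replaced by the Gaussian `t ^ ∑ α_i ^ 2`, whose matrices are, after diagonal scaling, rank one minus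
a positive multiple of the identity; then `t → 0`. The support is cut out by upper bounds on initial
sums, and exchange is proved directly (`mConvex_nestedSet`).

Character side. The vectors `f^s v`, with `s` a multiset of negative roots and `v` the highest
weight vector, form a basis of the Verma module. They span by reordering products. For independence,
`gl_m` acts by left invariant vector fields on polynomial functions of matrices; at the identity the
leading term of `E_b` is `∂_b`, so ordered products are independent operators
(`linearIndependent_listMonomial_unitOp`). A functional that reads off the lower triangular factor,
with the upper triangular one acting by a character, kills the defining left ideal and separates the
`f^s v` (`exists_functional_vermaIdeal`). Counting basis vectors of a given weight gives the
partition function. -/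

noncomputable section

namespace VermaLorentzian

/-! ### Lorentzian bilinear forms -/

section Forms

variable {V : Type*} [AddCommGroup V] [Module ℝ V]

/-- A bilinear form satisfies the reversed Cauchy–Schwarz inequality on its positive vectors. -/
def IsLorentzForm (A : LinearMap.BilinForm ℝ V) : Prop :=
  ∀ v x : V, 0 < A v v → A v v * A x x ≤ A v x ^ 2

/-- A positive vector `v` lies off the hyperplane `l = 0`, so some `x - t • v` lies in it.
Multiplying the inequality there by `A v v` gives the claim up to the square of `A v x - t * A v v`.
-/
theorem isLorentzForm_of_nonpos_on_ker {A : LinearMap.BilinForm ℝ V} (hA : ∀ x y, A x y = A y x)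
    (l : V →ₗ[ℝ] ℝ) (h : ∀ x, l x = 0 → A x x ≤ 0) : IsLorentzForm A := by
  intro v x hv
  have hl : l v ≠ 0 := fun h0 => absurd (h v h0) (not_le.mpr hv)
  have h1 := h (x - (l x / l v) • v) (by simp [hl])
  generalize l x / l v = t at h1
  simp only [map_sub, map_smul, LinearMap.sub_apply, LinearMap.smul_apply, smul_eq_mul] at h1
  rw [hA x v] at h1
  nlinarith [sq_nonneg (A v x - t * A v v), mul_nonneg hv.le (sub_nonneg.mpr h1)]

theorem IsLorentzForm.nonpos_of_orthogonal {A : LinearMap.BilinForm ℝ V} (h : IsLorentzForm A)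
    {v x : V} (hv : 0 < A v v) (hx : A v x = 0) : A x x ≤ 0 := by
  have h1 := h v x hv
  rw [hx] at h1
  nlinarith

/-- A sum of Lorentzian forms `A 0, …, A n`, each of which is linked to the next one by
`A k q = A (k + 1) p`, is again Lorentzian. -/
theorem isLorentzForm_sum_of_linked {A : ℕ → LinearMap.BilinForm ℝ V}
    (hsymm : ∀ k x y, A k x y = A k y x) (hA : ∀ k, IsLorentzForm (A k)) {p q : V}
    (hpq : ∀ k x, A k q x = A (k + 1) p x) (hpos : ∀ k, 0 < A k p p) (n : ℕ) :
    IsLorentzForm (∑ k ∈ Finset.range (n + 1), A k) := by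
  refine isLorentzForm_of_nonpos_on_ker (fun x y => ?_)
    (∑ k ∈ Finset.range (n + 1), A k q) fun x hx => ?_
  · simp only [LinearMap.sum_apply, hsymm _ x y]
  simp only [LinearMap.sum_apply] at hx ⊢
  set a : ℕ → ℝ := fun k => A k p p with ha
  set S : ℕ → ℝ := fun k => ∑ r ∈ Finset.range k, A r q x with hS
  -- Chosen so that `x - u k • p + u (k + 1) • q` is `A k`-orthogonal to `q`. The hypothesis on `x`
  -- says `S (n + 1) = 0`, so the corrections vanish at both ends.
  set u : ℕ → ℝ := fun k => -S k / a (k + 1) with hu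
  have hpq1 : ∀ k, A k q p = a (k + 1) := fun k => by rw [hpq, ha]
  have hqq : ∀ k, A k q q = a (k + 2) := fun k => by rw [hpq, hsymm, hpq]
  have hua : ∀ k, u k * a (k + 1) = -S k := fun k => by
    rw [hu]; exact div_mul_cancel₀ _ (hpos (k + 1)).ne'
  have hSs : ∀ k, S (k + 1) = S k + A k q x := fun k => Finset.sum_range_succ _ _
  have h0 : u 0 = 0 := by simp [hu, hS]
  have hn : u (n + 1) = 0 := by simp only [hu, hS, hx]; simp
  -- Nonpositivity of `A k` on the corrected vector reads `A k x x ≤ T k - T (k + 1)` with the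
  -- square `a (k + 1) * (u k - u (k + 1)) ^ 2` to spare.
  set T : ℕ → ℝ := fun k => 2 * u k * A k p x + u k ^ 2 * (a (k + 1) - a k) with hT
  have key : ∀ k, A k x x ≤ T k - T (k + 1) := by
    intro k
    have h1 := (hA k).nonpos_of_orthogonal (v := q) (x := x - u k • p + u (k + 1) • q)
      (by rw [hqq]; exact hpos _) (by
        simp only [map_add, map_sub, map_smul, smul_eq_mul, hpq1, hqq]
        have := hua k; have := hua (k + 1); have := hSs k
        linarith)
    simp only [map_add, map_sub, map_smul, LinearMap.add_apply, LinearMap.sub_apply,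
      LinearMap.smul_apply, smul_eq_mul, hqq, hpq1, hsymm k x p, hsymm k x q, hsymm k p q] at h1
    simp only [hT, ← hpq]
    have h2 : A k p p = a k := rfl
    rw [h2] at h1
    nlinarith [mul_nonneg (hpos (k + 1)).le (sq_nonneg (u k - u (k + 1)))]
  calc ∑ k ∈ Finset.range (n + 1), A k x x
      ≤ ∑ k ∈ Finset.range (n + 1), (T k - T (k + 1)) := Finset.sum_le_sum fun k _ => key k
    _ = T 0 - T (n + 1) := Finset.sum_range_sub' _ _
    _ = 0 := by simp [hT, h0, hn]

end Forms

/-! ### Sequences with Lorentzian quadratic forms -/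

section Sequences

variable {σ : Type*} [Fintype σ] [DecidableEq σ]

/-- The matrix `(c (γ + ε_i + ε_j))_{i, j}`. -/
def shiftMatrix (c : LaurentGF σ) (γ : σ → ℤ) : Matrix σ σ ℝ :=
  Matrix.of fun i j => c (γ + Pi.single i 1 + Pi.single j 1)

/-- The bilinear form of the matrix `(c (γ + ε_i + ε_j))_{i, j}`. -/
def shiftForm (c : LaurentGF σ) (γ : σ → ℤ) : LinearMap.BilinForm ℝ (σ → ℝ) :=
  Matrix.toBilin' (shiftMatrix c γ)

theorem shiftForm_apply (c : LaurentGF σ) (γ : σ → ℤ) (x y : σ → ℝ) :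
    shiftForm c γ x y = ∑ i, ∑ j, x i * c (γ + Pi.single i 1 + Pi.single j 1) * y j :=
  Matrix.toBilin'_apply _ _ _

theorem shiftForm_symm (c : LaurentGF σ) (γ : σ → ℤ) (x y : σ → ℝ) :
    shiftForm c γ x y = shiftForm c γ y x := by
  rw [shiftForm_apply, shiftForm_apply, Finset.sum_comm]
  refine Finset.sum_congr rfl fun i _ => Finset.sum_congr rfl fun j _ => ?_
  rw [add_right_comm]; ring

theorem shiftForm_single_left (c : LaurentGF σ) (γ : σ → ℤ) (i : σ) (y : σ → ℝ) :
    shiftForm c γ (Pi.single i 1) y = ∑ j, c (γ + Pi.single i 1 + Pi.single j 1) * y j := by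
  rw [shiftForm_apply, Finset.sum_eq_single i]
  · simp
  · intro b _ hb; simp [hb]
  · simp

theorem shiftForm_single_single (c : LaurentGF σ) (γ : σ → ℤ) (i j : σ) :
    shiftForm c γ (Pi.single i 1) (Pi.single j 1) = c (γ + Pi.single i 1 + Pi.single j 1) :=
  Matrix.toBilin'_single _ _ _

/-- All the forms `shiftForm c γ` are Lorentzian. -/
def IsLorentzSeq (c : LaurentGF σ) : Prop := ∀ γ, IsLorentzForm (shiftForm c γ)

/-- Translating by `ε_p - ε_q` trades an `ε_q` for an `ε_p`, so row `q` of each matrix is row `p` of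
the next: this is the link. Positivity of `c` makes the entries at `(p, p)` positive. -/
theorem IsLorentzSeq.window {c : LaurentGF σ} (hc : IsLorentzSeq c) (hpos : ∀ α, 0 < c α)
    (p q : σ) (n : ℕ) :
    IsLorentzSeq fun α => ∑ k ∈ Finset.range (n + 1),
      c (α - k • (Pi.single p 1 - Pi.single q 1 : σ → ℤ)) := by
  intro γ
  have h : shiftForm (fun α => ∑ k ∈ Finset.range (n + 1),
      c (α - k • (Pi.single p 1 - Pi.single q 1 : σ → ℤ))) γ = ∑ k ∈ Finset.range (n + 1),
      shiftForm c (γ - k • (Pi.single p 1 - Pi.single q 1 : σ → ℤ)) := by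
    simp only [shiftForm]
    rw [← map_sum]
    congr 1
    ext i j
    rw [Matrix.sum_apply]
    simp only [shiftMatrix, Matrix.of_apply]
    refine Finset.sum_congr rfl fun k _ => congrArg c ?_
    abel
  rw [h]
  refine isLorentzForm_sum_of_linked (p := Pi.single p 1) (q := Pi.single q 1)
    (fun k => shiftForm_symm _ _) (fun k => hc _) (fun k x => ?_) (fun k => ?_) n
  · rw [shiftForm_single_left, shiftForm_single_left]
    refine Finset.sum_congr rfl fun j _ => ?_
    congr 2
    rw [add_smul, one_smul]
    abel
  · rw [shiftForm_single_single]
    exact hpos _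

/-- The sums over boxes of translates of `c` along `N` families of root directions. -/
theorem IsLorentzSeq.box {N : ℕ} (r : Fin N → σ × σ) (n : ℕ) :
    ∀ {c : LaurentGF σ}, IsLorentzSeq c → (∀ α, 0 < c α) →
      IsLorentzSeq fun α => ∑ k : Fin N → Fin (n + 1),
        c (α - ∑ s, (k s : ℕ) • (Pi.single (r s).1 1 - Pi.single (r s).2 1 : σ → ℤ)) := by
  induction N with
  | zero => intro c hc _; simpa using hc
  | succ N ih =>
    intro c hc hpos
    have h := ih (fun s => r s.succ) (hc.window hpos (r 0).1 (r 0).2 n)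
      (fun α => Finset.sum_pos (fun k _ => hpos _) ⟨0, by simp⟩)
    convert h using 2 with α
    rw [← Fintype.sum_equiv (Fin.consEquiv fun _ => Fin (n + 1)) _ _ (fun _ => rfl),
      Fintype.sum_prod_type, Finset.sum_comm]
    refine Finset.sum_congr rfl fun k _ => ?_
    rw [Finset.sum_range]
    refine Finset.sum_congr rfl fun k0 _ => congrArg c ?_
    rw [Fin.sum_univ_succ]
    simp only [Fin.consEquiv_apply, Fin.cons_zero, Fin.cons_succ]
    abel

/-- The discrete Gaussian `α ↦ t ^ (∑ α_i ^ 2)`. -/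
def discreteGaussian (t : ℝ) : LaurentGF σ := fun α => t ^ ∑ i, (α i).natAbs ^ 2

/-- Expanding the square norm of `γ + ε_i + ε_j` writes the matrix as a positive multiple of `D (J -
(1 - t²) I) D`, with `J` all ones and `D` diagonal with entries `t ^ (2 γ_i)`. It is nonpositive on
the kernel of `J D`. -/
theorem isLorentzSeq_discreteGaussian {t : ℝ} (h0 : 0 < t) (h1 : t < 1) :
    IsLorentzSeq (discreteGaussian t : LaurentGF σ) := by
  intro γ
  have hz : ∀ α : σ → ℤ, discreteGaussian t α = t ^ (∑ i, α i ^ 2 : ℤ) := fun α => by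
    rw [discreteGaussian, ← zpow_natCast]
    simp
  have entry : ∀ i j, discreteGaussian t (γ + Pi.single i 1 + Pi.single j 1) =
      t ^ (∑ i, γ i ^ 2 + 2 : ℤ) * (t ^ (2 * γ i) * t ^ (2 * γ j) *
        (1 - (1 - t ^ 2) * if i = j then 1 else 0)) := by
    intro i j
    have hs : (∑ l, (γ + Pi.single i 1 + Pi.single j 1 : σ → ℤ) l ^ 2 : ℤ) =
        ∑ i, γ i ^ 2 + 2 + (2 * γ i + 2 * γ j + 2 * if i = j then 1 else 0) := by
      have : ∀ l, (γ + Pi.single i 1 + Pi.single j 1 : σ → ℤ) l ^ 2 = γ l ^ 2 +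
          (((if l = i then 2 * γ l + 1 else 0) + (if l = j then 2 * γ l + 1 else 0)) +
            if l = i then (if i = j then 2 else 0) else 0) := by
        intro l
        simp only [Pi.add_apply, Pi.single_apply]
        split_ifs <;> first | ring1 | (exfalso; simp_all)
      simp only [this, Finset.sum_add_distrib, Finset.sum_ite_eq', Finset.mem_univ, if_true]
      split_ifs <;> ring
    rw [hz, hs, zpow_add₀ h0.ne', zpow_add₀ h0.ne' (2 * γ i + 2 * γ j),
      zpow_add₀ h0.ne' (2 * γ i)]
    split_ifs
    · have : t ^ (2 * 1 : ℤ) = t ^ 2 := by norm_cast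
      rw [this]; ring
    · simp
  refine isLorentzForm_of_nonpos_on_ker (shiftForm_symm _ _)
    (∑ i, (t ^ (2 * γ i)) • LinearMap.proj i) fun x hx => ?_
  simp only [LinearMap.sum_apply, LinearMap.smul_apply, LinearMap.proj_apply, smul_eq_mul] at hx
  have : shiftForm (discreteGaussian t) γ x x = t ^ (∑ i, γ i ^ 2 + 2 : ℤ) *
      ((∑ i, t ^ (2 * γ i) * x i) * (∑ i, t ^ (2 * γ i) * x i) -
        (1 - t ^ 2) * ∑ i, (t ^ (2 * γ i) * x i) ^ 2) := by
    rw [shiftForm_apply, Finset.sum_mul_sum, Finset.mul_sum, ← Finset.sum_sub_distrib,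
      Finset.mul_sum]
    refine Finset.sum_congr rfl fun i _ => ?_
    have : (1 - t ^ 2) * (t ^ (2 * γ i) * x i) ^ 2 =
        ∑ j, if i = j then (1 - t ^ 2) * (t ^ (2 * γ i) * x i) * (t ^ (2 * γ j) * x j) else 0 := by
      simp only [Finset.sum_ite_eq, Finset.mem_univ, if_true]; ring
    rw [this, ← Finset.sum_sub_distrib, Finset.mul_sum]
    refine Finset.sum_congr rfl fun j _ => ?_
    rw [entry]
    split_ifs <;> ring
  rw [this, hx]
  have h2 : 0 ≤ 1 - t ^ 2 := by nlinarith
  have h3 : 0 ≤ ∑ i, (t ^ (2 * γ i) * x i) ^ 2 := Finset.sum_nonneg fun i _ => sq_nonneg _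
  have h4 : 0 < t ^ (∑ i, γ i ^ 2 + 2 : ℤ) := zpow_pos h0 _
  nlinarith [mul_nonneg h4.le (mul_nonneg h2 h3)]

open Filter Topology

/-- Lorentzian sequences are closed under pointwise limits. -/
theorem IsLorentzSeq.of_tendsto {ι : Type*} {l : Filter ι} [l.NeBot] {f : ι → LaurentGF σ}
    {c : LaurentGF σ} (hf : ∀ᶠ t in l, IsLorentzSeq (f t))
    (hlim : ∀ α, Tendsto (fun t => f t α) l (𝓝 (c α))) : IsLorentzSeq c := by
  intro γ v x hv
  have hB : ∀ x y, Tendsto (fun t => shiftForm (f t) γ x y) l (𝓝 (shiftForm c γ x y)) := by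
    intro x y
    simp only [shiftForm_apply]
    exact tendsto_finsetSum _ fun i _ => tendsto_finsetSum _ fun j _ =>
      ((hlim _).const_mul _).mul_const _
  refine le_of_tendsto_of_tendsto ((hB v v).mul (hB x x)) ((hB v x).pow 2) ?_
  -- The inequality is required only where `A v v > 0`, an open condition, so it is available for
  -- the nearby forms.
  filter_upwards [hf, (hB v v).eventually_const_lt hv] with t ht hpos
  exact ht γ v x hpos

/-- The box sums are taken before the limit `t → 0`, because the limiting delta sequence is no
longer positive. -/
theorem isLorentzSeq_boxCount {N : ℕ} (r : Fin N → σ × σ) (n : ℕ) :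
    IsLorentzSeq fun α => ∑ k : Fin N → Fin (n + 1), if
      α - ∑ s, (k s : ℕ) • (Pi.single (r s).1 1 - Pi.single (r s).2 1 : σ → ℤ) = 0
        then (1 : ℝ) else 0 := by
  refine IsLorentzSeq.of_tendsto (l := 𝓝[>] (0 : ℝ)) (f := fun t α =>
    ∑ k : Fin N → Fin (n + 1), discreteGaussian t
      (α - ∑ s, (k s : ℕ) • (Pi.single (r s).1 1 - Pi.single (r s).2 1 : σ → ℤ))) ?_ fun α => ?_
  · filter_upwards [Ioo_mem_nhdsGT (zero_lt_one' ℝ)] with t ht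
    exact (isLorentzSeq_discreteGaussian ht.1 ht.2).box r n fun α => pow_pos ht.1 _
  · refine tendsto_finsetSum _ fun k _ => ?_
    generalize α - ∑ s, (k s : ℕ) • (Pi.single (r s).1 1 - Pi.single (r s).2 1 : σ → ℤ) = β
    -- With `0 ^ 0 = 1`, the delta sequence is the Gaussian at `t = 0`, and powers are continuous
    -- there.
    have h : (if β = 0 then (1 : ℝ) else 0) = (0 : ℝ) ^ ∑ i, (β i).natAbs ^ 2 := by
      rw [zero_pow_eq]
      congr 1
      simp [Finset.sum_eq_zero_iff, funext_iff]
    rw [h]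
    exact ((continuous_pow _).tendsto (0 : ℝ)).mono_left nhdsWithin_le_nhds

end Sequences

/-! ### Nested sets of integral vectors -/

section Nested

variable {m : ℕ}

theorem sum_Iic_eq_add {i u : Fin m} (h : i ≤ u) (f : Fin m → ℤ) :
    ∑ l ∈ Finset.Iic u, f l = ∑ l ∈ Finset.Iio i, f l + ∑ l ∈ Finset.Icc i u, f l := by
  rw [← Finset.sum_union]
  · congr 1
    ext l
    simp only [Finset.mem_Iic, Finset.mem_union, Finset.mem_Iio, Finset.mem_Icc]
    omega
  · rw [Finset.disjoint_left]
    intro l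
    simp only [Finset.mem_Iio, Finset.mem_Icc]
    omega

theorem sum_Iio_eq_add {i t : Fin m} (h : t < i) (f : Fin m → ℤ) :
    ∑ l ∈ Finset.Iio i, f l = ∑ l ∈ Finset.Iic t, f l + ∑ l ∈ Finset.Ioo t i, f l := by
  rw [← Finset.sum_union]
  · congr 1
    ext l
    simp only [Finset.mem_Iic, Finset.mem_union, Finset.mem_Iio, Finset.mem_Ioo]
    omega
  · rw [Finset.disjoint_left]
    intro l
    simp only [Finset.mem_Iic, Finset.mem_Ioo]
    omega

theorem sum_Iic_sub_add (α : Fin m → ℤ) (i j t : Fin m) :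
    ∑ l ∈ Finset.Iic t, (α - Pi.single i 1 + Pi.single j 1 : Fin m → ℤ) l =
      ∑ l ∈ Finset.Iic t, α l - (if i ≤ t then 1 else 0) + if j ≤ t then 1 else 0 := by
  simp [Finset.sum_add_distrib, Finset.sum_sub_distrib, Pi.single_apply]

theorem sum_sub_add (α : Fin m → ℤ) (i j : Fin m) :
    ∑ l, (α - Pi.single i 1 + Pi.single j 1 : Fin m → ℤ) l = ∑ l, α l := by
  simp [Finset.sum_add_distrib, Finset.sum_sub_distrib, Pi.single_apply]

/-- The nonnegative integral vectors with the same sum as `d` and with initial sums at most those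
of `d`. -/
def nestedSet (d : Fin m → ℤ) : Set (Fin m → ℤ) :=
  {α | (∀ i, 0 ≤ α i) ∧ ∑ i, α i = ∑ i, d i ∧
    ∀ t, ∑ l ∈ Finset.Iic t, α l ≤ ∑ l ∈ Finset.Iic t, d l}

theorem nonneg_sub_add {α : Fin m → ℤ} (hα : ∀ l, 0 ≤ α l) {i : Fin m} (hi : 0 < α i)
    (j l : Fin m) : 0 ≤ (α - Pi.single i 1 + Pi.single j 1 : Fin m → ℤ) l := by
  have := hα l
  simp only [Pi.add_apply, Pi.sub_apply, Pi.single_apply]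
  split_ifs with h1 h2 <;> first | omega | (subst h1; omega)

/-- If `β` has initial sum at least that of `α` at some `u ≥ i`, and `α ≥ β` in between, then
there is an exchange to the left of `i`. -/
theorem exists_exchange_left {d α β : Fin m → ℤ} (hα : α ∈ nestedSet d) (hβ : β ∈ nestedSet d)
    {i u : Fin m} (hi : β i < α i) (hu : i ≤ u)
    (hsum : ∑ l ∈ Finset.Iic u, α l ≤ ∑ l ∈ Finset.Iic u, β l)
    (hge : ∀ l, i < l → l ≤ u → β l ≤ α l) :
    ∃ j, α j < β j ∧ α - Pi.single i 1 + Pi.single j 1 ∈ nestedSet d ∧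
      β - Pi.single j 1 + Pi.single i 1 ∈ nestedSet d := by
  have hlt : ∑ l ∈ Finset.Iio i, α l < ∑ l ∈ Finset.Iio i, β l := by
    have h1 : ∑ l ∈ Finset.Icc i u, β l < ∑ l ∈ Finset.Icc i u, α l := by
      refine Finset.sum_lt_sum (fun l hl => ?_) ⟨i, by simpa using hu, hi⟩
      rw [Finset.mem_Icc] at hl
      rcases hl.1.eq_or_lt with h | h
      · rw [← h]; exact hi.le
      · exact hge l h hl.2
    rw [sum_Iic_eq_add hu, sum_Iic_eq_add hu] at hsum
    linarith
  obtain ⟨j0, hj0, hj0'⟩ := Finset.exists_lt_of_sum_lt hlt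
  -- The largest such `j` makes the initial sums of `α` strictly smaller than those of `β` on `[j,
  -- i)`, exactly where `α - ε_i + ε_j` gains one.
  obtain ⟨j, hj, hmax⟩ := Finset.exists_max_image
    ((Finset.Iio i).filter fun j => α j < β j) id ⟨j0, by simp_all⟩
  simp only [Finset.mem_filter, Finset.mem_Iio, id] at hj hmax
  have hstrict : ∀ t, j ≤ t → t < i →
      ∑ l ∈ Finset.Iic t, α l < ∑ l ∈ Finset.Iic t, β l := by
    intro t hjt hti
    have h1 : ∑ l ∈ Finset.Ioo t i, β l ≤ ∑ l ∈ Finset.Ioo t i, α l := by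
      refine Finset.sum_le_sum fun l hl => ?_
      rw [Finset.mem_Ioo] at hl
      by_contra! h
      have := hmax l ⟨hl.2, h⟩
      exact absurd (hjt.trans_lt hl.1) (not_lt.mpr this)
    rw [sum_Iio_eq_add hti, sum_Iio_eq_add hti] at hlt
    linarith
  refine ⟨j, hj.2, ⟨nonneg_sub_add hα.1 ((hβ.1 i).trans_lt hi) j, ?_, fun t => ?_⟩,
    ⟨nonneg_sub_add hβ.1 ((hα.1 j).trans_lt hj.2) i, ?_, fun t => ?_⟩⟩
  · rw [sum_sub_add, hα.2.1]
  · rw [sum_Iic_sub_add]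
    have h1 := hα.2.2 t
    have h2 := hβ.2.2 t
    by_cases hit : i ≤ t
    · rw [if_pos hit, if_pos (hj.1.le.trans hit)]; linarith
    · by_cases hjt : j ≤ t
      · have := hstrict t hjt (not_le.mp hit)
        rw [if_neg hit, if_pos hjt]; linarith
      · rw [if_neg hit, if_neg hjt]; linarith
  · rw [sum_sub_add, hβ.2.1]
  · rw [sum_Iic_sub_add]
    have h2 := hβ.2.2 t
    by_cases hit : i ≤ t
    · rw [if_pos hit, if_pos (hj.1.le.trans hit)]; linarith
    · rw [if_neg hit]; split_ifs <;> linarith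

/-- The nearest `j > i` with `α j < β j` works unless `β` already attains a bound of `d` somewhere
on `[i, j)`, where `β - ε_j + ε_i` gains one. Such a tight place, or the common total when there is
no such `j`, provides an exchange to the left. -/
theorem mConvex_nestedSet (d : Fin m → ℤ) : MConvex (nestedSet d) := by
  intro i α hα β hβ hi
  by_cases hX : ∃ j, i < j ∧ α j < β j
  · obtain ⟨j0, hj0⟩ := hX
    obtain ⟨j, hj, hmin⟩ := Finset.exists_min_image
      (Finset.univ.filter fun j => i < j ∧ α j < β j) id ⟨j0, by simp [hj0]⟩
    simp only [Finset.mem_filter, Finset.mem_univ, true_and, id] at hj hmin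
    by_cases htight : ∃ u, i ≤ u ∧ u < j ∧ ∑ l ∈ Finset.Iic u, d l ≤ ∑ l ∈ Finset.Iic u, β l
    · obtain ⟨u, hiu, huj, hu⟩ := htight
      refine exists_exchange_left hα hβ hi hiu ((hα.2.2 u).trans hu) fun l hil hlu => ?_
      by_contra! h
      exact absurd (hlu.trans_lt huj) (not_lt.mpr (hmin l ⟨hil, h⟩))
    · push Not at htight
      refine ⟨j, hj.2, ⟨nonneg_sub_add hα.1 ((hβ.1 i).trans_lt hi) j, ?_, fun t => ?_⟩,
        ⟨nonneg_sub_add hβ.1 ((hα.1 j).trans_lt hj.2) i, ?_, fun t => ?_⟩⟩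
      · rw [sum_sub_add, hα.2.1]
      · rw [sum_Iic_sub_add]
        have h1 := hα.2.2 t
        by_cases hjt : j ≤ t
        · rw [if_pos hjt, if_pos (hj.1.le.trans hjt)]; linarith
        · rw [if_neg hjt]; split_ifs <;> linarith
      · rw [sum_sub_add, hβ.2.1]
      · rw [sum_Iic_sub_add]
        have h2 := hβ.2.2 t
        by_cases hjt : j ≤ t
        · rw [if_pos hjt, if_pos (hj.1.le.trans hjt)]; linarith
        · by_cases hit : i ≤ t
          · have := htight t hit (not_le.mp hjt)
            rw [if_neg hjt, if_pos hit]; linarith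
          · rw [if_neg hjt, if_neg hit]; linarith
  · push Not at hX
    obtain ⟨n, rfl⟩ : ∃ n, m = n + 1 := ⟨m - 1, by have := i.isLt; omega⟩
    refine exists_exchange_left hα hβ hi (Fin.le_last i) ?_ fun l hil _ => hX l hil
    have : Finset.Iic (Fin.last n) = Finset.univ := by
      ext l; simp [Fin.le_last]
    rw [this, hα.2.1, hβ.2.1]

/-- Two vectors with the same initial sums are equal. -/
theorem eq_of_sum_Iic_eq {α β : Fin m → ℤ}
    (h : ∀ t, ∑ l ∈ Finset.Iic t, α l = ∑ l ∈ Finset.Iic t, β l) : α = β := by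
  funext i
  induction i using WellFoundedLT.induction with
  | ind i ih =>
    have h1 := h i
    rw [← Finset.Iio_insert, Finset.sum_insert (by simp), Finset.sum_insert (by simp),
      Finset.sum_congr rfl fun j hj => ih j (Finset.mem_Iio.mp hj)] at h1
    exact add_right_cancel h1

end Nested

/-! ### Kostant's partition function -/

section Kostant

/-- The negative roots `ε_i - ε_j`, `i > j`, as pairs `(i, j)`. -/
abbrev NegRoot (m : ℕ) := {p : Fin m × Fin m // p.2 < p.1}

/-- The vector `∑ k_{ij} (ε_i - ε_j)`. -/
def rootSum (m : ℕ) : (NegRoot m → ℕ) →+ (Fin m → ℤ) where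
  toFun k := ∑ p, k p • (Pi.single p.1.1 1 - Pi.single p.1.2 1 : Fin m → ℤ)
  map_zero' := by simp
  map_add' k l := by simp [Finset.sum_add_distrib, add_smul]

variable {m : ℕ}

theorem rootSum_apply (k : NegRoot m → ℕ) :
    rootSum m k = ∑ p, k p • (Pi.single p.1.1 1 - Pi.single p.1.2 1 : Fin m → ℤ) := rfl

theorem rootSum_single (p : NegRoot m) :
    rootSum m (Pi.single p 1) = Pi.single p.1.1 1 - Pi.single p.1.2 1 := by
  rw [rootSum_apply, Finset.sum_eq_single p]
  · simp
  · intro q _ hq; simp [hq]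
  · simp

theorem rootSum_pair (k : NegRoot m → ℕ) (w : Fin m → ℤ) :
    ∑ i, rootSum m k i * w i = ∑ p, (k p : ℤ) * (w p.1.1 - w p.1.2) := by
  simp only [rootSum_apply, Finset.sum_apply, Finset.sum_mul]
  rw [Finset.sum_comm]
  refine Finset.sum_congr rfl fun p _ => ?_
  simp [mul_sub, sub_mul, Pi.single_apply, Finset.sum_sub_distrib]

theorem sum_rootSum (k : NegRoot m → ℕ) : ∑ i, rootSum m k i = 0 := by
  simpa using rootSum_pair k 1

/-- Pairing with `i ↦ i` gives every negative root `ε_i - ε_j`, `i > j`, a value at least `1`, so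
the total bounds each multiplicity. Finiteness and truncation both rest on this. -/
theorem le_of_rootSum (k : NegRoot m → ℕ) (p : NegRoot m) :
    k p ≤ (∑ i, rootSum m k i * (i : ℕ)).natAbs := by
  have h := rootSum_pair k fun i => ((i : ℕ) : ℤ)
  have h1 : ∀ q : NegRoot m, (k q : ℤ) ≤ k q * (((q.1.1 : ℕ) : ℤ) - (q.1.2 : ℕ)) := by
    intro q
    have : (q.1.2 : ℕ) < q.1.1 := q.2
    nlinarith
  have h2 : (k p : ℤ) ≤ ∑ i, rootSum m k i * (i : ℕ) := by
    rw [h]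
    exact (h1 p).trans (Finset.single_le_sum
      (f := fun q : NegRoot m => (k q : ℤ) * (((q.1.1 : ℕ) : ℤ) - (q.1.2 : ℕ)))
      (fun q _ => (Int.natCast_nonneg _).trans (h1 q)) (Finset.mem_univ p))
  omega

instance finite_rootSum_fiber (ν : Fin m → ℤ) : Finite {k // rootSum m k = ν} := by
  refine Finite.of_injective (β := NegRoot m → Fin ((∑ i, ν i * (i : ℕ)).natAbs + 1))
    (fun k p => ⟨k.1 p, ?_⟩) fun k l h => ?_
  · have := le_of_rootSum k.1 p
    rw [k.2] at this
    omega
  · ext p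
    have := congrFun h p
    simpa using this

theorem geometricProduct_eq_card (ν : Fin m → ℤ) :
    geometricProduct m ν = (Nat.card {k // rootSum m k = ν} : ℝ) := rfl

theorem geometricProduct_ne_zero_iff (ν : Fin m → ℤ) :
    geometricProduct m ν ≠ 0 ↔ ∃ k, rootSum m k = ν := by
  rw [geometricProduct_eq_card, Nat.cast_ne_zero, Nat.card_ne_zero]
  simp [finite_rootSum_fiber, nonempty_subtype]

/-- For the converse the roots `ε_{t+1} - ε_t` suffice: their multiplicities are the negated initial
sums of `ν`. -/
theorem exists_rootSum_iff (ν : Fin m → ℤ) : (∃ k, rootSum m k = ν) ↔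
    ∑ i, ν i = 0 ∧ ∀ t, ∑ l ∈ Finset.Iic t, ν l ≤ 0 := by
  constructor
  · rintro ⟨k, rfl⟩
    refine ⟨sum_rootSum k, fun t => ?_⟩
    have h := rootSum_pair k fun i => if i ≤ t then 1 else 0
    simp only [mul_ite, mul_one, mul_zero, ← Finset.sum_filter] at h
    have : Finset.univ.filter (· ≤ t) = Finset.Iic t := by ext; simp
    rw [this] at h
    rw [h]
    refine Finset.sum_nonpos fun p _ => ?_
    have := p.2
    split_ifs
    · simp
    · omega
    · simp
    · simp
  · rintro ⟨h0, h⟩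
    obtain _ | n := m
    · exact ⟨0, Subsingleton.elim _ _⟩
    suffices hν : ν ∈ AddMonoidHom.mrange (rootSum (n + 1)) from hν
    set s : Fin n → ℤ := fun t => ∑ l ∈ Finset.Iic t.castSucc, ν l with hs
    have : ν = ∑ t : Fin n, (-s t).toNat •
        (Pi.single t.succ 1 - Pi.single t.castSucc 1 : Fin (n + 1) → ℤ) := by
      refine eq_of_sum_Iic_eq fun u => ?_
      have h1 : ∀ t : Fin n, ∑ l ∈ Finset.Iic u, ((-s t).toNat •
          (Pi.single t.succ 1 - Pi.single t.castSucc 1 : Fin (n + 1) → ℤ)) l =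
          if u = t.castSucc then s t else 0 := by
        intro t
        have : ((-s t).toNat : ℤ) = -s t := Int.toNat_of_nonneg (neg_nonneg.mpr (h t.castSucc))
        simp only [Pi.smul_apply, nsmul_eq_mul, this, Pi.sub_apply, ← Finset.mul_sum,
          Finset.sum_sub_distrib]
        simp only [Finset.sum_pi_single', Finset.mem_Iic]
        have : (t.succ ≤ u) ↔ (t : ℕ) + 1 ≤ u := by simp [Fin.le_def]
        have : (t.castSucc ≤ u) ↔ (t : ℕ) ≤ u := by simp [Fin.le_def]
        have : (u = t.castSucc) ↔ (u : ℕ) = t := by simp [Fin.ext_iff]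
        split_ifs <;> omega
      simp only [Finset.sum_apply]
      rw [Finset.sum_comm]
      simp only [h1]
      induction u using Fin.lastCases with
      | last =>
        have : Finset.Iic (Fin.last n) = Finset.univ := by ext l; simp [Fin.le_last]
        rw [this, h0]
        symm
        refine Finset.sum_eq_zero fun t _ => if_neg ?_
        exact (Fin.castSucc_lt_last t).ne'
      | cast t => simp [hs]
    rw [this]
    refine AddSubmonoid.sum_mem _ fun t _ => AddSubmonoid.nsmul_mem _ ?_ _
    exact ⟨Pi.single ⟨(t.succ, t.castSucc), Fin.castSucc_lt_succ⟩ 1, rootSum_single _⟩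

theorem geometricProduct_eq_boxCount {ν : Fin m → ℤ} {n : ℕ}
    (hn : (∑ i, ν i * (i : ℕ)).natAbs ≤ n) :
    geometricProduct m ν = ∑ k : NegRoot m → Fin (n + 1),
      if rootSum m (fun p => k p) = ν then (1 : ℝ) else 0 := by
  classical
  rw [geometricProduct_eq_card, Finset.sum_boole]
  congr 1
  rw [← Fintype.card_subtype, ← Nat.card_eq_fintype_card]
  refine Nat.card_congr (Equiv.symm
    ⟨fun k => ⟨fun p => k.1 p, k.2⟩, fun k => ⟨fun p => ⟨k.1 p, ?_⟩, k.2⟩, ?_, ?_⟩)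
  · have := le_of_rootSum k.1 p
    rw [k.2] at this
    omega
  · intro k; rfl
  · intro k; rfl

/-- One matrix involves finitely many values, so for a single large `n` its entries are unchanged
when multiplicities are truncated at `n`. -/
theorem isLorentzSeq_geometricProduct (m : ℕ) : IsLorentzSeq (geometricProduct m) := by
  intro γ
  set f : Fin m → Fin m → Fin m → ℤ := fun i j => γ + Pi.single i 1 + Pi.single j 1
  set n : ℕ := ∑ i, ∑ j, (∑ l, f i j l * (l : ℕ)).natAbs
  have hn : ∀ i j, (∑ l, f i j l * (l : ℕ)).natAbs ≤ n := fun i j =>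
    (Finset.single_le_sum (f := fun j => (∑ l, f i j l * (l : ℕ)).natAbs) (fun _ _ => Nat.zero_le _)
      (Finset.mem_univ j)).trans (Finset.single_le_sum
      (f := fun i => ∑ j, (∑ l, f i j l * (l : ℕ)).natAbs) (fun _ _ => Nat.zero_le _)
      (Finset.mem_univ i))
  have h := isLorentzSeq_boxCount (fun s => ((Fintype.equivFin (NegRoot m)).symm s).1) n γ
  convert h using 1
  simp only [shiftForm]
  congr 1
  ext i j
  simp only [shiftMatrix, Matrix.of_apply]
  rw [geometricProduct_eq_boxCount (hn i j)]
  refine Fintype.sum_equiv ((Fintype.equivFin (NegRoot m)).arrowCongr (Equiv.refl _)) _ _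
    fun k => ?_
  congr 1
  rw [sub_eq_zero, eq_comm, rootSum_apply]
  simp only [f]
  rw [← Equiv.sum_comp (Fintype.equivFin (NegRoot m)) (fun s => _ • _)]
  simp only [Equiv.arrowCongr_apply, Equiv.coe_refl, Function.comp_apply,
    Equiv.symm_apply_apply, id]
  exact propext eq_comm

end Kostant

/-! ### Lorentzian polynomials from Lorentzian sequences -/

section Polynomials

variable {σ : Type*} [Fintype σ] [DecidableEq σ]

/-- Two orthogonal eigenvectors with positive eigenvalues would make the left side of reversed
Cauchy–Schwarz positive and the right side zero. -/
theorem atMostOnePosEigenvalue_of_isLorentzForm {q : MvPolynomial σ ℝ}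
    (h : IsLorentzForm (Matrix.toBilin' (hessian q))) : AtMostOnePosEigenvalue q := by
  rw [AtMostOnePosEigenvalue, Finset.card_le_one]
  intro i hi j hj
  simp only [Finset.mem_filter, Finset.mem_univ, true_and] at hi hj
  by_contra hij
  set hH := hessian_isHermitian q
  have hv : ∀ a b, Matrix.toBilin' (hessian q) (hH.eigenvectorBasis a) (hH.eigenvectorBasis b) =
      hH.eigenvalues b * if a = b then 1 else 0 := by
    intro a b
    rw [Matrix.toBilin'_apply', hH.mulVec_eigenvectorBasis, dotProduct_smul, smul_eq_mul]
    congr 1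
    have := orthonormal_iff_ite.mp hH.eigenvectorBasis.orthonormal b a
    rw [EuclideanSpace.inner_eq_star_dotProduct] at this
    simpa [eq_comm] using this
  have h1 := h (hH.eigenvectorBasis i) (hH.eigenvectorBasis j) (by rw [hv]; simpa using hi)
  rw [hv, hv, hv, if_neg hij] at h1
  simp only [if_true, mul_one, mul_zero] at h1
  nlinarith [mul_pos hi hj]

/-- `p` is the exponential generating function of the values of `c` on `ℕ^σ`. -/
def IsEGF (p : MvPolynomial σ ℝ) (c : LaurentGF σ) : Prop :=
  ∀ a : σ →₀ ℕ, p.coeff a * ∏ i, ((a i).factorial : ℝ) = c fun i => (a i : ℤ)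

/-- The factor `a i + 1` produced by differentiation is absorbed by the factorial. -/
theorem IsEGF.pderiv {p : MvPolynomial σ ℝ} {c : LaurentGF σ} (h : IsEGF p c) (i : σ) :
    IsEGF (pderiv i p) fun α => c (α + Pi.single i 1) := by
  intro a
  have h1 := h (a + Finsupp.single i 1)
  have h2 : (fun j => (((a + Finsupp.single i 1 : σ →₀ ℕ) j : ℕ) : ℤ)) =
      (fun j => (a j : ℤ)) + Pi.single i 1 := by
    funext j
    by_cases hj : j = i
    · subst hj; simp
    · simp [hj]
  rw [h2] at h1
  change _ = c ((fun j => (a j : ℤ)) + Pi.single i 1)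
  rw [← h1, coeff_pderiv, mul_assoc]
  congr 1
  rw [← Finset.mul_prod_erase _ _ (Finset.mem_univ i),
    ← Finset.mul_prod_erase _ (fun j => (((a + Finsupp.single i 1 : σ →₀ ℕ) j).factorial : ℝ))
      (Finset.mem_univ i), ← mul_assoc]
  congr 1
  · simp [Nat.factorial_succ]
  · refine Finset.prod_congr rfl fun j hj => ?_
    rw [Finsupp.add_apply, Finsupp.single_eq_of_ne (Finset.ne_of_mem_erase hj), add_zero]

theorem IsEGF.iterPDeriv {p : MvPolynomial σ ℝ} {c : LaurentGF σ} (h : IsEGF p c) (s : List σ) :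
    ∃ γ, IsEGF (iterPDeriv s p) fun α => c (α + γ) := by
  induction s with
  | nil => exact ⟨0, by simpa [VermaLorentzian.iterPDeriv] using h⟩
  | cons i s ih =>
    obtain ⟨γ, hγ⟩ := ih
    exact ⟨Pi.single i 1 + γ, by
      have := hγ.pderiv i
      simp only [add_assoc] at this
      exact this⟩

theorem IsEGF.hessian_eq {p : MvPolynomial σ ℝ} {c : LaurentGF σ} (h : IsEGF p c) :
    hessian p = shiftMatrix c 0 := by
  ext i j
  have := ((h.pderiv j).pderiv i) 0
  simp only [Finsupp.coe_zero, Pi.zero_apply, Nat.factorial_zero, Nat.cast_one,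
    Finset.prod_const_one, mul_one, Nat.cast_zero] at this
  exact this

theorem IsEGF.isLorentzian {p : MvPolynomial σ ℝ} {c : LaurentGF σ} (h : IsEGF p c)
    (hc : IsLorentzSeq c) (h0 : ∀ α, 0 ≤ c α) {d : ℕ} (hd : ∀ α, c α ≠ 0 → ∑ i, α i = d)
    (hJ : MConvex {α | (∀ i, 0 ≤ α i) ∧ c α ≠ 0}) : IsLorentzian p := by
  have hfac : ∀ a : σ →₀ ℕ, 0 < ∏ i, ((a i).factorial : ℝ) := fun a =>
    Finset.prod_pos fun i _ => Nat.cast_pos.mpr (Nat.factorial_pos _)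
  have hne : ∀ a, p.coeff a ≠ 0 ↔ c (fun i => (a i : ℤ)) ≠ 0 := fun a => by
    rw [← h a, mul_ne_zero_iff, and_iff_left (hfac a).ne']
  refine ⟨d, fun a ha => ?_, fun a => ?_, ?_, fun s _ => ?_⟩
  · have := hd _ ((hne a).mp ha)
    rw [show Finsupp.weight (1 : σ → ℕ) a = a.degree from
      (DFunLike.congr_fun (Finsupp.degree_eq_weight_one (R := ℕ)) a).symm, Finsupp.degree_eq_sum]
    exact_mod_cast this
  · have := h0 fun i => (a i : ℤ)
    rw [← h a] at this
    exact nonneg_of_mul_nonneg_left this (hfac a)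
  · convert hJ using 1
    ext α
    constructor
    · rintro ⟨a, ha, hα⟩
      have : α = fun i => (a i : ℤ) := funext hα
      subst this
      exact ⟨fun i => Int.natCast_nonneg _, (hne a).mp (mem_support_iff.mp ha)⟩
    · rintro ⟨hα, hcα⟩
      have : α = fun i => ((Finsupp.equivFunOnFinite.symm fun i => (α i).toNat) i : ℤ) := by
        funext i
        simp [hα i]
      refine ⟨Finsupp.equivFunOnFinite.symm fun i => (α i).toNat, ?_, fun i => congrFun this i⟩
      rw [mem_support_iff, hne, ← this]
      exact hcα
  · obtain ⟨γ, hγ⟩ := h.iterPDeriv s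
    refine atMostOnePosEigenvalue_of_isLorentzForm ?_
    rw [hγ.hessian_eq]
    convert hc γ using 1
    rw [shiftForm]
    congr 1
    ext i j
    simp only [shiftMatrix, Matrix.of_apply]
    congr 1
    abel

/-- The normalization of a sequence supported in a fixed degree is a polynomial. -/
theorem exists_isEGF {c : LaurentGF σ} {d : ℕ} (hd : ∀ α, c α ≠ 0 → ∑ i, α i = d) :
    ∃ p : MvPolynomial σ ℝ, (p : MvPowerSeries σ ℝ) = c.normalize ∧ IsEGF p c := by
  classical
  set p : MvPolynomial σ ℝ := ∑ a ∈ Finset.univ.finsuppAntidiag d, 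
    monomial a (MvPowerSeries.coeff a c.normalize)
  have hp : ∀ a, p.coeff a = MvPowerSeries.coeff a c.normalize := by
    intro a
    simp only [p, coeff_sum, coeff_monomial]
    rw [Finset.sum_eq_single a (fun b _ hb => if_neg hb), if_pos rfl]
    · intro ha
      rw [if_pos rfl]
      have : c (fun i => (a i : ℤ)) = 0 := by
        by_contra h
        refine ha (Finset.mem_finsuppAntidiag.mpr ⟨?_, Finset.subset_univ _⟩)
        exact_mod_cast hd _ h
      change c (fun i => (a i : ℤ)) / _ = 0
      rw [this, zero_div]
  refine ⟨p, ?_, fun a => ?_⟩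
  · ext a
    rw [coeff_coe, hp]
  · rw [hp]
    exact div_mul_cancel₀ _ (Finset.prod_pos fun i _ => Nat.cast_pos.mpr (Nat.factorial_pos _)).ne'

end Polynomials

/-- The normalization of a monomial multiple of `∏_{i > j} (1 - x_i x_j⁻¹)⁻¹` is a Lorentzian
polynomial. -/
theorem exists_isLorentzian_normalize {m : ℕ} (δ : Fin m → ℕ) :
    ∃ p : MvPolynomial (Fin m) ℝ,
      (p : MvPowerSeries (Fin m) ℝ) = ((geometricProduct m).monomialMul δ).normalize ∧
      IsLorentzian p := by
  have hsupp : ∀ α, (geometricProduct m).monomialMul δ α ≠ 0 ↔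
      ∑ i, α i = ∑ i, (δ i : ℤ) ∧
        ∀ t, ∑ l ∈ Finset.Iic t, α l ≤ ∑ l ∈ Finset.Iic t, (δ l : ℤ) := by
    intro α
    rw [LaurentGF.monomialMul, geometricProduct_ne_zero_iff, exists_rootSum_iff]
    simp only [Finset.sum_sub_distrib, sub_eq_zero, sub_nonpos]
  have hd : ∀ α, (geometricProduct m).monomialMul δ α ≠ 0 → ∑ i, α i = (∑ i, δ i : ℕ) := by
    intro α hα
    rw [((hsupp α).mp hα).1, Nat.cast_sum]
  obtain ⟨p, hp, hegf⟩ := exists_isEGF hd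
  refine ⟨p, hp, hegf.isLorentzian (fun γ => ?_) (fun α => Nat.cast_nonneg _) hd ?_⟩
  · convert isLorentzSeq_geometricProduct m (γ - fun i => (δ i : ℤ)) using 1
    simp only [shiftForm]
    congr 1
    ext i j
    simp only [shiftMatrix, Matrix.of_apply, LaurentGF.monomialMul]
    congr 1
    funext l
    simp only [Pi.add_apply, Pi.sub_apply]
    ring
  · convert mConvex_nestedSet fun i => (δ i : ℤ) using 1
    ext α
    simp only [hsupp]
    rfl

/-! ### Reordering products in an associative algebra -/

section Reordering

variable {K A ι : Type*} [CommRing K] [Ring A] [Algebra K A]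

/-- The product of the elements `X i` for `i` in a list. -/
def listMonomial (X : ι → A) (l : List ι) : A := (l.map X).prod

@[simp]
theorem listMonomial_nil (X : ι → A) : listMonomial X [] = 1 := rfl

@[simp]
theorem listMonomial_cons (X : ι → A) (i : ι) (l : List ι) :
    listMonomial X (i :: l) = X i * listMonomial X l := by
  simp [listMonomial]

@[simp]
theorem listMonomial_append (X : ι → A) (l l' : List ι) :
    listMonomial X (l ++ l') = listMonomial X l * listMonomial X l' := by
  simp [listMonomial]

theorem listMonomial_map {κ : Type*} (X : ι → A) (f : κ → ι) (l : List κ) :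
    listMonomial X (l.map f) = listMonomial (X ∘ f) l := by
  simp [listMonomial]

variable (K) in
/-- The span of the products of at most `n` of the elements `X i`. -/
def monomialSpan (X : ι → A) (n : ℕ) : Submodule K A :=
  Submodule.span K (listMonomial X '' {l | l.length ≤ n})

theorem listMonomial_mem_monomialSpan (X : ι → A) {l : List ι} {n : ℕ} (h : l.length ≤ n) :
    listMonomial X l ∈ monomialSpan K X n :=
  Submodule.subset_span ⟨l, h, rfl⟩

theorem mul_mem_monomialSpan (X : ι → A) (i : ι) {n : ℕ} {a : A} (h : a ∈ monomialSpan K X n) :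
    X i * a ∈ monomialSpan K X (n + 1) := by
  induction h using Submodule.span_induction with
  | mem x hx =>
    obtain ⟨l, hl, rfl⟩ := hx
    rw [← listMonomial_cons]
    exact listMonomial_mem_monomialSpan X (by simpa using hl)
  | zero => simp
  | add x y _ _ hx hy => rw [mul_add]; exact add_mem hx hy
  | smul c x _ hx => rw [mul_smul_comm]; exact Submodule.smul_mem _ c hx

/-- An adjacent swap changes the product by one in which a commutator, a combination of single
generators, replaces two factors; the error is thus shorter. -/
theorem listMonomial_sub_mem_of_perm {X : ι → A}
    (hX : ∀ i j, X i * X j - X j * X i ∈ Submodule.span K (Set.range X)) {l l' : List ι}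
    (h : l.Perm l') :
    ∀ n, l.length ≤ n + 1 → listMonomial X l - listMonomial X l' ∈ monomialSpan K X n := by
  induction h with
  | nil => intro n _; simp
  | @cons x l l' hp ih =>
    intro n hn
    rw [listMonomial_cons, listMonomial_cons, ← mul_sub]
    obtain _ | n := n
    · obtain rfl : l = [] := List.length_eq_zero_iff.mp (by simpa using hn)
      obtain rfl := hp.nil_eq
      simp
    · exact mul_mem_monomialSpan X x (ih n (by simpa using hn))
  | swap x y l =>
    intro n hn
    simp only [listMonomial_cons, ← mul_assoc, ← sub_mul]
    have hxy := hX y x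
    generalize X y * X x - X x * X y = z at hxy ⊢
    induction hxy using Submodule.span_induction with
    | mem z hz =>
      obtain ⟨i, rfl⟩ := hz
      rw [← listMonomial_cons]
      exact listMonomial_mem_monomialSpan X (by simpa using hn)
    | zero => simp
    | add u v _ _ hu hv => rw [add_mul]; exact add_mem hu hv
    | smul c u _ hu => rw [smul_mul_assoc]; exact Submodule.smul_mem _ c hu
  | trans h₁ _ ih₁ ih₂ =>
    intro n hn
    rw [← sub_add_sub_cancel]
    exact add_mem (ih₁ n hn) (ih₂ n (h₁.length_eq ▸ hn))

/-- If every list is a permutation of a list in `N`, the products over lists in `N` span all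
products. -/
theorem listMonomial_mem_span_of_perm {X : ι → A}
    (hX : ∀ i j, X i * X j - X j * X i ∈ Submodule.span K (Set.range X)) {N : Set (List ι)}
    (hN : ∀ l : List ι, ∃ l' ∈ N, l.Perm l') (l : List ι) :
    listMonomial X l ∈ Submodule.span K (listMonomial X '' N) := by
  suffices h : ∀ n (l : List ι), l.length ≤ n →
      listMonomial X l ∈ Submodule.span K (listMonomial X '' N) from h _ l le_rfl
  intro n
  induction n with
  | zero =>
    intro l hl
    obtain rfl : l = [] := List.length_eq_zero_iff.mp (by simpa using hl)
    obtain ⟨l', hl', hp⟩ := hN []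
    obtain rfl := hp.nil_eq
    exact Submodule.subset_span ⟨_, hl', rfl⟩
  | succ n ih =>
    intro l hl
    obtain ⟨l', hl', hp⟩ := hN l
    rw [← sub_add_cancel (listMonomial X l) (listMonomial X l')]
    refine add_mem ?_ (Submodule.subset_span ⟨_, hl', rfl⟩)
    refine (Submodule.span_le (p := Submodule.span K (listMonomial X '' N))).mpr ?_
      (listMonomial_sub_mem_of_perm hX hp n hl)
    rintro _ ⟨l₂, hl₂, rfl⟩
    exact ih l₂ hl₂

theorem mem_span_of_mem_adjoin {X : ι → A}
    (hX : ∀ i j, X i * X j - X j * X i ∈ Submodule.span K (Set.range X)) {N : Set (List ι)}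
    (hN : ∀ l : List ι, ∃ l' ∈ N, l.Perm l') {a : A} (ha : a ∈ Algebra.adjoin K (Set.range X)) :
    a ∈ Submodule.span K (listMonomial X '' N) := by
  rw [← Subalgebra.mem_toSubmodule, Algebra.adjoin_eq_span] at ha
  refine Submodule.span_le.mpr ?_ ha
  intro x hx
  obtain ⟨l, hl, rfl⟩ := Submonoid.exists_list_of_mem_closure hx
  obtain ⟨l, rfl⟩ : l ∈ Set.range (List.map X) := by
    rw [Set.range_list_map]
    exact hl
  exact listMonomial_mem_span_of_perm hX hN l

/-- A linear map that is multiplicative with respect to `χ` on products over lists in `N` is so on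
all products, if every list is a permutation of a list in `N` and `χ` kills commutators. -/
theorem map_listMonomial_of_perm {V : Type*} [AddCommGroup V] [Module K V] {X : ι → A}
    {χ : ι → K} (hX : ∀ i j, ∃ c : ι →₀ K,
      X i * X j - X j * X i = Finsupp.linearCombination K X c ∧
      Finsupp.linearCombination K χ c = 0)
    {N : Set (List ι)} (hN : ∀ l : List ι, ∃ l' ∈ N, l.Perm l') (Ψ : A →ₗ[K] V) (v : V)
    (h : ∀ l ∈ N, Ψ (listMonomial X l) = (l.map χ).prod • v) (l : List ι) :
    Ψ (listMonomial X l) = (l.map χ).prod • v := by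
  induction hn : l.length using Nat.strong_induction_on generalizing l with
  | h n ih =>
  -- The prefix `p` collects the factors to the left of the swap, since `Ψ` can only be compared on
  -- whole products.
  have key : ∀ {l₁ l₂ : List ι}, l₁.Perm l₂ → ∀ p : List ι, (p ++ l₁).length = n →
      Ψ (listMonomial X (p ++ l₁)) = Ψ (listMonomial X (p ++ l₂)) := by
    intro l₁ l₂ hp
    induction hp with
    | nil => intro p _; rfl
    | cons x _ ih' =>
      intro p hp
      have := ih' (p ++ [x]) (by simpa using hp)
      simpa using this
    | swap x y l₀ =>
      intro p hp
      rw [← sub_eq_zero, ← map_sub]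
      simp only [listMonomial_append, listMonomial_cons]
      rw [← mul_sub, ← mul_assoc, ← mul_assoc, ← sub_mul]
      -- The commutator terms are shorter products, so induction evaluates them; their sum is a
      -- multiple of the value of `χ` on the commutator, which is zero.
      obtain ⟨c, hc, hχ⟩ := hX y x
      rw [hc, Finsupp.linearCombination_apply, Finsupp.sum, Finset.sum_mul, Finset.mul_sum, map_sum]
      rw [Finsupp.linearCombination_apply, Finsupp.sum] at hχ
      have : ∀ k ∈ c.support, Ψ (listMonomial X p * (c k • X k * listMonomial X l₀)) =
          (c k • χ k) • ((p.map χ).prod * (l₀.map χ).prod) • v := by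
        intro k _
        have := ih (p ++ k :: l₀).length (by simp at hp ⊢; omega) (p ++ k :: l₀) rfl
        rw [smul_mul_assoc, mul_smul_comm, map_smul]
        simp only [listMonomial_append, listMonomial_cons, List.map_append, List.map_cons,
          List.prod_append, List.prod_cons] at this
        rw [this, smul_smul, smul_smul]
        congr 1
        simp only [smul_eq_mul]
        ring
      rw [Finset.sum_congr rfl this, ← Finset.sum_smul, hχ, zero_smul]
    | trans h₁ _ ih₁ ih₂ =>
      intro p hp
      rw [ih₁ p hp, ih₂ p (by simpa [h₁.length_eq] using hp)]
  obtain ⟨l', hl', hp⟩ := hN l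
  have h1 := key hp [] (by simpa using hn)
  simp only [List.nil_append] at h1
  rw [h1, h l' hl', (hp.map χ).prod_eq]

end Reordering

/-! ### Generators of the enveloping algebra -/

section Generation

attribute [local instance] LieRing.ofAssociativeRing

variable {K L : Type*} [CommRing K] [LieRing L] [LieAlgebra K L]

/-- By the universal property, `ι` lifts to a map into the generated subalgebra whose composite with
the inclusion is the identity. -/
theorem adjoin_range_ι_eq_top :
    Algebra.adjoin K (Set.range (UniversalEnvelopingAlgebra.ι K : L → _)) = ⊤ := by
  set S := Algebra.adjoin K (Set.range (UniversalEnvelopingAlgebra.ι K : L → _))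
  let f : L →ₗ⁅K⁆ S :=
    { toFun := fun x => ⟨UniversalEnvelopingAlgebra.ι K x, Algebra.subset_adjoin ⟨x, rfl⟩⟩
      map_add' := fun x y => Subtype.ext (map_add _ x y)
      map_smul' := fun c x => Subtype.ext (map_smul _ c x)
      map_lie' := fun {x y} => Subtype.ext
        (LieHom.map_lie (UniversalEnvelopingAlgebra.ι K) x y) }
  have h : S.val.comp (UniversalEnvelopingAlgebra.lift K f) = AlgHom.id K _ := by
    apply UniversalEnvelopingAlgebra.hom_ext
    ext x
    change S.val (UniversalEnvelopingAlgebra.lift K f (UniversalEnvelopingAlgebra.ι K x)) =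
      UniversalEnvelopingAlgebra.ι K x
    rw [UniversalEnvelopingAlgebra.lift_ι_apply]
    rfl
  rw [eq_top_iff]
  intro u _
  have := DFunLike.congr_fun h u
  rw [AlgHom.id_apply] at this
  rw [← this]
  exact (UniversalEnvelopingAlgebra.lift K f u).2

theorem adjoin_range_ι_comp_eq_top {ι : Type*} {x : ι → L}
    (hx : Submodule.span K (Set.range x) = ⊤) :
    Algebra.adjoin K (Set.range fun i => UniversalEnvelopingAlgebra.ι K (x i)) = ⊤ := by
  rw [eq_top_iff, ← adjoin_range_ι_eq_top (K := K) (L := L), Algebra.adjoin_le_iff]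
  rintro _ ⟨y, rfl⟩
  have hy : y ∈ Submodule.span K (Set.range x) := hx ▸ Submodule.mem_top
  induction hy using Submodule.span_induction with
  | mem z hz =>
    obtain ⟨i, rfl⟩ := hz
    exact Algebra.subset_adjoin ⟨i, rfl⟩
  | zero => rw [map_zero]; exact zero_mem _
  | add u v _ _ hu hv => rw [map_add]; exact add_mem hu hv
  | smul c u _ hu => rw [map_smul]; exact Subalgebra.smul_mem _ hu c

end Generation

/-! ### Differential operators on polynomial functions of matrices -/

section Operators

variable {m : ℕ}

/-- Polynomial functions in the entries of the matrix `y`, where `1 + y` is the generic matrix. -/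
abbrev MatPoly (m : ℕ) := MvPolynomial (Fin m × Fin m) ℂ

/-- The derivation `∑ f_b ∂_b` of the polynomial ring. -/
def vectorField (f : Fin m × Fin m → MatPoly m) : Derivation ℂ (MatPoly m) (MatPoly m) :=
  ∑ b, f b • pderiv b

theorem vectorField_apply (f : Fin m × Fin m → MatPoly m) (F : MatPoly m) :
    vectorField f F = ∑ b, f b * pderiv b F := by
  rw [vectorField, ← Derivation.coeFnAddMonoidHom_apply, map_sum, Finset.sum_apply]
  rfl

theorem vectorField_X (f : Fin m × Fin m → MatPoly m) (b : Fin m × Fin m) :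
    vectorField f (X b) = f b := by
  rw [vectorField_apply, Finset.sum_eq_single b]
  · simp
  · intro c _ hc; simp [pderiv_X_of_ne hc.symm]
  · simp

/-- The left invariant vector field of the matrix `M`, in the coordinates `y = g - 1`. -/
def invariantField (M : Matrix (Fin m) (Fin m) ℂ) : Derivation ℂ (MatPoly m) (MatPoly m) :=
  vectorField fun b => C (M b.1 b.2) + ∑ i, X (b.1, i) * C (M i b.2)

theorem invariantField_X (M : Matrix (Fin m) (Fin m) ℂ) (a b : Fin m) :
    invariantField M (X (a, b)) = C (M a b) + ∑ i, X (a, i) * C (M i b) :=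
  vectorField_X _ _

theorem invariantField_add (M N : Matrix (Fin m) (Fin m) ℂ) :
    invariantField (M + N) = invariantField M + invariantField N := by
  refine derivation_ext fun ⟨a, b⟩ => ?_
  simp only [Derivation.add_apply, invariantField_X, Matrix.add_apply, map_add, mul_add,
    Finset.sum_add_distrib]
  ring

theorem invariantField_smul (c : ℂ) (M : Matrix (Fin m) (Fin m) ℂ) :
    invariantField (c • M) = c • invariantField M := by
  refine derivation_ext fun ⟨a, b⟩ => ?_
  simp only [Derivation.smul_apply, invariantField_X, Matrix.smul_apply, smul_eq_mul, map_mul,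
    smul_eq_C_mul, mul_add, Finset.mul_sum]
  congr 1
  exact Finset.sum_congr rfl fun i _ => by ring

/-- On the generic matrix `g = 1 + y` the field of `M` gives `g M`; applied to `g N` with `N`
constant it gives `g M N`. -/
theorem invariantField_comp_X (M N : Matrix (Fin m) (Fin m) ℂ) (a b : Fin m) :
    invariantField M (invariantField N (X (a, b))) =
      invariantField (M * N) (X (a, b)) := by
  have hC : ∀ c : ℂ, invariantField M (C c) = 0 := fun c => by
    rw [invariantField, vectorField_apply]; simp
  have hX : ∀ i, invariantField M (X (a, i) * C (N i b)) =
      C (M a i) * C (N i b) + ∑ j, X (a, j) * (C (M j i) * C (N i b)) := fun i => by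
    rw [Derivation.leibniz, hC, smul_zero, zero_add, smul_eq_mul, invariantField_X, mul_comm,
      add_mul, Finset.sum_mul]
    simp only [mul_assoc]
  rw [invariantField_X, invariantField_X, map_add, hC, zero_add, map_sum]
  simp only [hX, Matrix.mul_apply, map_sum, map_mul, Finset.sum_add_distrib, Finset.mul_sum]
  rw [Finset.sum_comm]

theorem invariantField_lie (M N : Matrix (Fin m) (Fin m) ℂ) :
    invariantField ⁅M, N⁆ = ⁅invariantField M, invariantField N⁆ := by
  refine derivation_ext fun ⟨a, b⟩ => ?_
  rw [Derivation.commutator_apply, invariantField_comp_X, invariantField_comp_X, Ring.lie_def,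
    sub_eq_add_neg, invariantField_add, ← neg_one_smul ℂ (N * M), invariantField_smul,
    Derivation.add_apply, Derivation.smul_apply, neg_one_smul, sub_eq_add_neg]

attribute [local instance] LieRing.ofAssociativeRing

/-- The representation of `gl_m` by left invariant vector fields. -/
def invariantRep (m : ℕ) : Matrix (Fin m) (Fin m) ℂ →ₗ⁅ℂ⁆ Module.End ℂ (MatPoly m) where
  toFun M := (invariantField M : MatPoly m →ₗ[ℂ] MatPoly m)
  map_add' M N := by rw [invariantField_add]; rfl
  map_smul' c M := by rw [invariantField_smul]; rfl
  map_lie' {M N} := by rw [invariantField_lie, Derivation.commutator_coe_linear_map]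

theorem invariantRep_apply (M : Matrix (Fin m) (Fin m) ℂ) (F : MatPoly m) :
    invariantRep m M F = invariantField M F := rfl

/-- The operator of the elementary matrix `E_b`. -/
def unitOp (b : Fin m × Fin m) : Module.End ℂ (MatPoly m) :=
  invariantRep m (Matrix.single b.1 b.2 1)

/-- The first term, the value of the field at the identity `y = 0`, lowers the degree by one; the
sum preserves it. This splitting replaces a symbol calculus. -/
theorem unitOp_apply (b : Fin m × Fin m) (F : MatPoly m) :
    unitOp b F = pderiv b F + ∑ a, X (a, b.1) * pderiv (a, b.2) F := by
  obtain ⟨i, j⟩ := b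
  rw [unitOp, invariantRep_apply, invariantField, vectorField_apply]
  simp only [add_mul, Finset.sum_add_distrib, Fintype.sum_prod_type, Matrix.single_apply]
  congr 1
  · rw [Finset.sum_eq_single i, Finset.sum_eq_single j]
    · simp
    · intro c _ hc; simp [hc.symm]
    · simp
    · intro c _ hc; simp [hc.symm]
    · simp
  · refine Finset.sum_congr rfl fun a _ => ?_
    rw [Finset.sum_eq_single j, Finset.sum_eq_single i]
    · simp
    · intro c _ hc; simp [hc.symm]
    · simp
    · intro c _ hc; simp [hc.symm]
    · simp

theorem invariantRep_eq_sum (M : Matrix (Fin m) (Fin m) ℂ) :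
    invariantRep m M = ∑ i, ∑ j, M i j • unitOp (i, j) := by
  conv_lhs => rw [Matrix.matrix_eq_sum_single M]
  rw [map_sum]
  refine Finset.sum_congr rfl fun i _ => ?_
  rw [map_sum]
  refine Finset.sum_congr rfl fun j _ => ?_
  rw [unitOp, ← map_smul, Matrix.smul_single, smul_eq_mul, mul_one]

theorem unitOp_commutator (a b : Fin m × Fin m) :
    unitOp a * unitOp b - unitOp b * unitOp a =
      (if a.2 = b.1 then unitOp (a.1, b.2) else 0) -
        if b.2 = a.1 then unitOp (b.1, a.2) else 0 := by
  have h : unitOp a * unitOp b - unitOp b * unitOp a = ⁅unitOp a, unitOp b⁆ := rfl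
  rw [h, unitOp, unitOp, ← LieHom.map_lie, Ring.lie_def, map_sub]
  congr 1
  · split_ifs with h
    · rw [h, Matrix.single_mul_single_same, mul_one, unitOp]
    · rw [Matrix.single_mul_single_of_ne _ _ _ _ h, map_zero]
  · split_ifs with h
    · rw [h, Matrix.single_mul_single_same, mul_one, unitOp]
    · rw [Matrix.single_mul_single_of_ne _ _ _ _ h, map_zero]

/-- The part of `unitOp b` that preserves the degree. -/
theorem isHomogeneous_unitOp_sub {F : MatPoly m} {r : ℕ} (hF : F.IsHomogeneous r) (hr : 0 < r)
    (b : Fin m × Fin m) : (∑ a, X (a, b.1) * pderiv (a, b.2) F : MatPoly m).IsHomogeneous r := by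
  refine IsHomogeneous.sum _ _ _ fun a _ => ?_
  have := (isHomogeneous_X ℂ (a, b.1)).mul (hF.pderiv (i := (a, b.2)))
  rwa [Nat.add_sub_cancel' hr] at this

/-- Each operator lowers the degree by at most one. Induction peels off the last factor, which acts
first. -/
theorem constantCoeff_listMonomial_of_lt {F : MatPoly m} {r : ℕ} (hF : F.IsHomogeneous r)
    (l : List (Fin m × Fin m)) (hl : l.length < r) :
    constantCoeff (listMonomial unitOp l F) = 0 := by
  induction l using List.reverseRecOn generalizing F r with
  | nil =>
    rw [listMonomial_nil, Module.End.one_apply]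
    by_contra h
    have := hF h
    simp at this hl
    omega
  | append_singleton l b ih =>
    rw [List.length_append, List.length_singleton] at hl
    rw [listMonomial_append, listMonomial_cons, listMonomial_nil, mul_one, Module.End.mul_apply,
      unitOp_apply, map_add, map_add, ih (hF.pderiv (i := b)) (by omega),
      ih (isHomogeneous_unitOp_sub hF (by omega) b) (by omega), add_zero]

/-- With exactly as many operators as the degree, every one of them must lower it, so only `∂_b`
contributes. -/
theorem constantCoeff_listMonomial_append {F : MatPoly m} (l : List (Fin m × Fin m))
    (b : Fin m × Fin m) (hF : F.IsHomogeneous (l.length + 1)) :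
    constantCoeff (listMonomial unitOp (l ++ [b]) F) =
      constantCoeff (listMonomial unitOp l (pderiv b F)) := by
  rw [listMonomial_append, listMonomial_cons, listMonomial_nil, mul_one, Module.End.mul_apply,
    unitOp_apply, map_add, map_add,
    constantCoeff_listMonomial_of_lt (isHomogeneous_unitOp_sub hF (by omega) b) l (by omega),
    add_zero]

theorem isHomogeneous_monomial_toFinsupp (s : Multiset (Fin m × Fin m)) :
    (monomial (Multiset.toFinsupp s) (1 : ℂ)).IsHomogeneous s.card := by
  refine isHomogeneous_monomial _ ?_
  induction s using Multiset.induction with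
  | empty => simp
  | cons a s ih =>
    rw [← Multiset.singleton_add, map_add, map_add, ih, Multiset.toFinsupp_singleton,
      Finsupp.degree_single, Multiset.card_add, Multiset.card_singleton]

/-- In this degree the product acts as the iterated partial derivative, which detects precisely its
own monomial. -/
theorem constantCoeff_listMonomial_monomial_ne_zero_iff (l : List (Fin m × Fin m))
    (s : Multiset (Fin m × Fin m)) (hs : s.card = l.length) :
    constantCoeff (listMonomial unitOp l (monomial (Multiset.toFinsupp s) (1 : ℂ))) ≠ 0 ↔
      s = l := by
  induction l using List.reverseRecOn generalizing s with
  | nil =>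
    obtain rfl : s = 0 := by simpa using hs
    simp
  | append_singleton l b ih =>
    have hhom : (monomial (Multiset.toFinsupp s) (1 : ℂ)).IsHomogeneous (l.length + 1) := by
      have := isHomogeneous_monomial_toFinsupp s
      rwa [hs, List.length_append, List.length_singleton] at this
    rw [constantCoeff_listMonomial_append l b hhom, pderiv_monomial, one_mul]
    by_cases hb : b ∈ s
    · obtain ⟨t, rfl⟩ := Multiset.exists_cons_of_mem hb
      have h1 : Multiset.toFinsupp (b ::ₘ t) - Finsupp.single b 1 = Multiset.toFinsupp t := by
        rw [← Multiset.singleton_add, map_add, Multiset.toFinsupp_singleton, add_tsub_cancel_left]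
      have h2 : (monomial (Multiset.toFinsupp t)
          ((Multiset.toFinsupp (b ::ₘ t) b : ℕ) : ℂ) : MatPoly m) =
          ((Multiset.toFinsupp (b ::ₘ t) b : ℕ) : ℂ) • monomial (Multiset.toFinsupp t) 1 := by
        rw [smul_monomial, smul_eq_mul, mul_one]
      rw [h1, h2, map_smul, constantCoeff_smul, smul_eq_mul, mul_ne_zero_iff,
        ih t (by simpa using hs), and_iff_right (by simp [Nat.cast_add_one_ne_zero])]
      rw [← Multiset.coe_add, Multiset.coe_singleton, add_comm, Multiset.singleton_add,
        Multiset.cons_inj_right]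
    · have h1 : Multiset.toFinsupp s b = 0 := by simpa using hb
      rw [h1]
      simp only [Nat.cast_zero, map_zero, ne_eq, not_true_eq_false, false_iff]
      rintro rfl
      simp at hb

/-- Products of the operators `unitOp b` over lists representing different multisets are linearly
independent. -/
theorem linearIndependent_listMonomial_unitOp {κ : Type*} (f : κ → List (Fin m × Fin m))
    (hf : ∀ a b, (f a : Multiset (Fin m × Fin m)) = f b → a = b) :
    LinearIndependent ℂ fun a => listMonomial (unitOp (m := m)) (f a) := by
  rw [linearIndependent_iff]
  intro c hc
  by_contra h
  -- Test the relation on the monomial of a longest term: shorter terms vanish by degree, and other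
  -- terms of equal length because their multisets differ.
  obtain ⟨a₀, ha₀, hmax⟩ := Finset.exists_max_image c.support (fun a => (f a).length)
    (Finsupp.support_nonempty_iff.mpr h)
  set F : MatPoly m := monomial (Multiset.toFinsupp (f a₀ : Multiset (Fin m × Fin m))) 1
  have h1 : constantCoeff (Finsupp.linearCombination ℂ
      (fun a => listMonomial (unitOp (m := m)) (f a)) c F) = 0 := by rw [hc]; simp
  rw [Finsupp.linearCombination_apply, Finsupp.sum, LinearMap.sum_apply, map_sum,
    Finset.sum_eq_single_of_mem a₀ ha₀] at h1
  · rw [LinearMap.smul_apply, constantCoeff_smul, smul_eq_mul] at h1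
    refine (mul_ne_zero (Finsupp.mem_support_iff.mp ha₀) ?_) h1
    exact (constantCoeff_listMonomial_monomial_ne_zero_iff _ _ rfl).mpr rfl
  · intro a ha hne
    rw [LinearMap.smul_apply, constantCoeff_smul, smul_eq_mul]
    refine mul_eq_zero_of_right _ ?_
    rcases (hmax a ha).lt_or_eq with hlt | heq
    · exact constantCoeff_listMonomial_of_lt (isHomogeneous_monomial_toFinsupp _) _ hlt
    · by_contra h0
      have := (constantCoeff_listMonomial_monomial_ne_zero_iff (f a) (f a₀) heq.symm).mp h0
      exact hne (hf _ _ this.symm)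

end Operators

/-! ### The Poincaré–Birkhoff–Witt basis of a Verma module -/

section SumLists

variable {α β : Type*}

theorem toList_cons_perm (a : α) (s : Multiset α) : (a ::ₘ s).toList.Perm (a :: s.toList) := by
  rw [← Multiset.coe_eq_coe, Multiset.coe_toList, ← Multiset.cons_coe, Multiset.coe_toList]

theorem exists_perm_inl_append_inr (l : List (α ⊕ β)) :
    ∃ (s : Multiset α) (t : Multiset β),
      l.Perm (s.toList.map Sum.inl ++ t.toList.map Sum.inr) := by
  induction l with
  | nil => exact ⟨0, 0, by simp⟩
  | cons x l ih =>
    obtain ⟨s, t, h⟩ := ih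
    rcases x with a | b
    · exact ⟨a ::ₘ s, t, (h.cons _).trans
        (((toList_cons_perm a s).map Sum.inl).symm.append_right (t.toList.map Sum.inr))⟩
    · refine ⟨s, b ::ₘ t, (h.cons _).trans ?_⟩
      refine List.perm_middle.symm.trans ?_
      exact ((toList_cons_perm b t).map Sum.inr).symm.append_left _

end SumLists

/-! ### A character of the upper triangular matrices and its functional -/

section Functional

variable {m : ℕ}

/-- The matrix units spanning the upper triangular matrices. -/
abbrev BorelIndex (m : ℕ) := {p : Fin m × Fin m // p.1 ≤ p.2}

/-- The operators of the lower triangular matrix units. -/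
def negOp (p : NegRoot m) : Module.End ℂ (MatPoly m) := unitOp p.1

/-- The operators of the upper triangular matrix units. -/
def borelOp (p : BorelIndex m) : Module.End ℂ (MatPoly m) := unitOp p.1

theorem linearIndependent_negOp_mul_borelOp :
    LinearIndependent ℂ fun a : Multiset (NegRoot m) × Multiset (BorelIndex m) =>
      listMonomial negOp a.1.toList * listMonomial borelOp a.2.toList := by
  have h := linearIndependent_listMonomial_unitOp (m := m)
    (fun a : Multiset (NegRoot m) × Multiset (BorelIndex m) =>
      a.1.toList.map Subtype.val ++ a.2.toList.map Subtype.val) ?_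
  · convert h using 2 with a
    rw [listMonomial_append, listMonomial_map, listMonomial_map]
    rfl
  · rintro ⟨s, t⟩ ⟨s', t'⟩ h
    simp only [← Multiset.coe_add, ← Multiset.map_coe, Multiset.coe_toList] at h
    have h1 : ∀ s : Multiset (NegRoot m), ∀ t : Multiset (BorelIndex m),
        (s.map Subtype.val + t.map Subtype.val).filter (fun p => p.2 < p.1) = s.map Subtype.val ∧
        (s.map Subtype.val + t.map Subtype.val).filter (fun p => ¬ p.2 < p.1) =
          t.map Subtype.val := by
      intro s t
      have hs : ∀ p ∈ s.map Subtype.val, p.2 < p.1 := by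
        intro p hp
        obtain ⟨q, _, rfl⟩ := Multiset.mem_map.mp hp
        exact q.2
      have ht : ∀ p ∈ t.map Subtype.val, ¬ p.2 < p.1 := by
        intro p hp
        obtain ⟨q, _, rfl⟩ := Multiset.mem_map.mp hp
        exact not_lt.mpr q.2
      constructor
      · rw [Multiset.filter_add, Multiset.filter_eq_self.mpr hs, Multiset.filter_eq_nil.mpr ht,
          add_zero]
      · rw [Multiset.filter_add, Multiset.filter_eq_self.mpr ht,
          Multiset.filter_eq_nil.mpr fun p hp => not_not.mpr (hs p hp), zero_add]
    refine Prod.ext ?_ ?_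
    · exact Multiset.map_injective Subtype.val_injective
        ((h1 s t).1.symm.trans ((congrArg _ h).trans (h1 s' t').1))
    · exact Multiset.map_injective Subtype.val_injective
        ((h1 s t).2.symm.trans ((congrArg _ h).trans (h1 s' t').2))

/-- The character of the upper triangular matrices with diagonal values `w`. -/
def borelChar (w : Fin m → ℂ) (p : BorelIndex m) : ℂ := if p.1.1 = p.1.2 then w p.1.1 else 0

/-- If both terms of `[E_ij, E_kl]` occur, then `i ≤ j = k ≤ l = i` and they cancel; if only one
occurs, it is off the diagonal, where the character is zero. -/
theorem borelOp_commutator (w : Fin m → ℂ) (a b : BorelIndex m) : ∃ c : BorelIndex m →₀ ℂ,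
    borelOp a * borelOp b - borelOp b * borelOp a = Finsupp.linearCombination ℂ borelOp c ∧
      Finsupp.linearCombination ℂ (borelChar w) c = 0 := by
  obtain ⟨⟨i, j⟩, hij⟩ := a
  obtain ⟨⟨k, l⟩, hkl⟩ := b
  simp only at hij hkl
  refine ⟨(if h : j = k then Finsupp.single ⟨(i, l), hij.trans (h ▸ hkl)⟩ 1 else 0) -
    (if h : l = i then Finsupp.single ⟨(k, j), hkl.trans (h ▸ hij)⟩ 1 else 0), ?_, ?_⟩
  · rw [borelOp, borelOp, unitOp_commutator, map_sub]
    congr 1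
    · split_ifs <;> simp [borelOp]
    · split_ifs <;> simp [borelOp]
  · rw [map_sub, sub_eq_zero]
    by_cases h1 : j = k <;> by_cases h2 : l = i
    · subst h1 h2
      obtain rfl := le_antisymm hij hkl
      rfl
    · subst h1
      simp [h2, Ne.symm h2, borelChar]
    · subst h2
      simp [h1, Ne.symm h1, borelChar]
    · simp [h1, h2]

/-- A functional that reads off the lower triangular part of an ordered monomial, with the upper
triangular part acting through a character. -/
theorem exists_functional (w : Fin m → ℂ) :
    ∃ Φ : Module.End ℂ (MatPoly m) →ₗ[ℂ] (Multiset (NegRoot m) →₀ ℂ),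
      ∀ (s : Multiset (NegRoot m)) (l : List (BorelIndex m)),
        Φ (listMonomial negOp s.toList * listMonomial borelOp l) =
          (l.map (borelChar w)).prod • Finsupp.single s 1 := by
  have hli := linearIndependent_negOp_mul_borelOp (m := m)
  -- Values are prescribed for one chosen ordering of each multiset and extended arbitrarily to all
  -- endomorphisms; other orderings follow because the character kills commutators.
  obtain ⟨Φ, hΦ⟩ := LinearMap.exists_extend ((Module.Basis.span hli).constr ℂ
    fun a => (a.2.toList.map (borelChar w)).prod • Finsupp.single a.1 (1 : ℂ))
  refine ⟨Φ, fun s l => ?_⟩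
  refine map_listMonomial_of_perm (X := borelOp) (χ := borelChar w) (borelOp_commutator w)
    (N := Set.range fun t : Multiset (BorelIndex m) => t.toList)
    (fun l => ⟨_, ⟨(l : Multiset _), rfl⟩, ?_⟩)
    (Φ ∘ₗ LinearMap.mulLeft ℂ (listMonomial negOp s.toList)) (Finsupp.single s 1) ?_ l
  · rw [← Multiset.coe_eq_coe, Multiset.coe_toList]
  · rintro _ ⟨t, rfl⟩
    have := DFunLike.congr_fun hΦ (Module.Basis.span hli (s, t))
    rw [Module.Basis.constr_basis] at this
    rw [← this]
    simp [Module.Basis.span_apply]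

end Functional

/-! ### Linear independence of the vectors `f^s v` -/

section LinearIndependence

variable {m : ℕ}

/-- The lower triangular matrix units in `sl_m`. -/
def negElt (p : NegRoot m) : SL m := LieAlgebra.SpecialLinear.single p.1.1 p.1.2 p.2.ne' 1

/-- The lower triangular matrix units in the enveloping algebra. -/
def negU (p : NegRoot m) : U m := toU (negElt p)

attribute [local instance] LieRing.ofAssociativeRing

/-- The action of the enveloping algebra of `sl_m` by differential operators. -/
def envelopingRep (m : ℕ) : U m →ₐ[ℂ] Module.End ℂ (MatPoly m) :=
  UniversalEnvelopingAlgebra.lift ℂ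
    ((invariantRep m).comp (LieAlgebra.SpecialLinear.sl (Fin m) ℂ).incl)

theorem envelopingRep_toU (x : SL m) : envelopingRep m (toU x) = invariantRep m x.val := by
  rw [envelopingRep, toU, UniversalEnvelopingAlgebra.lift_ι_apply]
  rfl

theorem envelopingRep_negU (p : NegRoot m) : envelopingRep m (negU p) = negOp p := by
  rw [negU, envelopingRep_toU]
  rfl

theorem envelopingRep_listMonomial (l : List (NegRoot m)) :
    envelopingRep m (listMonomial negU l) = listMonomial negOp l := by
  induction l with
  | nil => simp
  | cons p l ih => rw [listMonomial_cons, map_mul, ih, envelopingRep_negU, listMonomial_cons]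

theorem unitOp_mem_range (b : Fin m × Fin m) :
    unitOp b ∈ Set.range (Sum.elim (negOp (m := m)) borelOp) := by
  rcases lt_or_ge b.2 b.1 with h | h
  · exact ⟨Sum.inl ⟨b, h⟩, rfl⟩
  · exact ⟨Sum.inr ⟨b, h⟩, rfl⟩

theorem envelopingRep_mem_adjoin (u : U m) :
    envelopingRep m u ∈ Algebra.adjoin ℂ (Set.range (Sum.elim (negOp (m := m)) borelOp)) := by
  have hu : u ∈ Algebra.adjoin ℂ (Set.range (UniversalEnvelopingAlgebra.ι ℂ : SL m → _)) := by
    rw [adjoin_range_ι_eq_top]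
    exact Algebra.mem_top
  induction hu using Algebra.adjoin_induction with
  | mem x hx =>
    obtain ⟨y, rfl⟩ := hx
    have := envelopingRep_toU y
    rw [toU] at this
    rw [this, invariantRep_eq_sum]
    exact sum_mem fun i _ => sum_mem fun j _ =>
      Subalgebra.smul_mem _ (Algebra.subset_adjoin (unitOp_mem_range _)) _
  | algebraMap r => rw [AlgHom.commutes]; exact Subalgebra.algebraMap_mem _ r
  | add x y _ _ hx hy => rw [map_add]; exact add_mem hx hy
  | mul x y _ _ hx hy => rw [map_mul]; exact mul_mem hx hy

/-- The functional is known only on ordered products of `gl_m` units, so the image of the enveloping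
algebra is expanded in them, lower triangular factors first. -/
theorem envelopingRep_mem_span (u : U m) :
    envelopingRep m u ∈ Submodule.span ℂ (Set.range
      fun a : Multiset (NegRoot m) × Multiset (BorelIndex m) =>
        listMonomial negOp a.1.toList * listMonomial borelOp a.2.toList) := by
  have h := mem_span_of_mem_adjoin (X := Sum.elim (negOp (m := m)) borelOp)
    (N := Set.range fun a : Multiset (NegRoot m) × Multiset (BorelIndex m) =>
      a.1.toList.map Sum.inl ++ a.2.toList.map Sum.inr) (fun i j => ?_) (fun l => ?_)
    (envelopingRep_mem_adjoin u)
  · rw [← Set.range_comp] at h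
    have hfun : (fun a : Multiset (NegRoot m) × Multiset (BorelIndex m) =>
        listMonomial negOp a.1.toList * listMonomial borelOp a.2.toList) =
        listMonomial (Sum.elim (negOp (m := m)) borelOp) ∘
          fun a => a.1.toList.map Sum.inl ++ a.2.toList.map Sum.inr := by
      funext a
      rw [Function.comp_apply, listMonomial_append, listMonomial_map, listMonomial_map]
      rfl
    rw [hfun]
    exact h
  · obtain ⟨a, ha⟩ : ∃ a, Sum.elim (negOp (m := m)) borelOp i = unitOp a := by
      rcases i with i | i <;> exact ⟨_, rfl⟩
    obtain ⟨b, hb⟩ : ∃ b, Sum.elim (negOp (m := m)) borelOp j = unitOp b := by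
      rcases j with j | j <;> exact ⟨_, rfl⟩
    rw [ha, hb, unitOp_commutator]
    refine sub_mem ?_ ?_ <;> split_ifs
    · exact Submodule.subset_span (unitOp_mem_range _)
    · exact zero_mem _
    · exact Submodule.subset_span (unitOp_mem_range _)
    · exact zero_mem _
  · obtain ⟨s, t, h⟩ := exists_perm_inl_append_inr l
    exact ⟨_, ⟨(s, t), rfl⟩, h⟩

/-- The value of a weight on a diagonal matrix, as a combination of its values on coroots. -/
theorem weight_eq_sum (lam : Module.Dual ℂ (cartan m)) (h : cartan m) :
    lam h = ∑ i, h.val.val i i * lam (coroot m i ⟨0, i.pos⟩) := by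
  simp only [← smul_eq_mul, ← map_smul]
  rw [← map_sum]
  congr 1
  apply Subtype.ext
  apply Subtype.ext
  have htr : ∑ i, h.val.val i i = 0 := h.val.2
  obtain _ | n := m
  · exact Subsingleton.elim _ _
  have hval : (∑ i, h.val.val i i • coroot (n + 1) i ⟨0, i.pos⟩ : cartan (n + 1)).val.val =
      ∑ i, h.val.val i i • (Matrix.single i i (1 : ℂ) - Matrix.single 0 0 1) := by
    let f : cartan (n + 1) →ₗ[ℂ] Matrix (Fin (n + 1)) (Fin (n + 1)) ℂ :=
      (LieAlgebra.SpecialLinear.sl (Fin (n + 1)) ℂ).toSubmodule.subtype ∘ₗ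
        (cartan (n + 1)).subtype
    exact map_sum f _ _
  rw [hval]
  simp only [smul_sub, Finset.sum_sub_distrib]
  rw [← Finset.sum_smul, htr, zero_smul, sub_zero]
  ext i j
  rw [Matrix.sum_apply]
  by_cases hij : i = j
  · subst hij
    rw [Finset.sum_eq_single i]
    · simp
    · intro b _ hb; simp [hb]
    · simp
  · rw [h.2 hij, Finset.sum_eq_zero]
    intro b _
    rw [Matrix.smul_apply, Matrix.single_apply_of_ne, smul_zero]
    rintro ⟨rfl, rfl⟩
    exact hij rfl

/-- A functional on the enveloping algebra that vanishes on the ideal of a Verma module and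
separates the products of lower triangular matrix units. -/
theorem exists_functional_vermaIdeal (lam : Module.Dual ℂ (cartan m)) :
    ∃ F : U m →ₗ[ℂ] (Multiset (NegRoot m) →₀ ℂ), (∀ u ∈ vermaIdeal lam, F u = 0) ∧
      ∀ s : Multiset (NegRoot m), F (listMonomial negU s.toList) = Finsupp.single s 1 := by
  -- These diagonal values extend `lam` to all diagonal matrices; by `weight_eq_sum` they agree with
  -- it on traceless ones.
  set w : Fin m → ℂ := fun i => lam (coroot m i ⟨0, i.pos⟩)
  obtain ⟨Φ, hΦ⟩ := exists_functional w
  refine ⟨Φ ∘ₗ (envelopingRep m).toLinearMap, ?_, fun s => ?_⟩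
  -- Generators of the left ideal appear as right factors, so compatibility with right
  -- multiplication is what is needed.
  · have key : ∀ (u : U m) (b : BorelIndex m), Φ (envelopingRep m u * borelOp b) =
        borelChar w b • Φ (envelopingRep m u) := by
      intro u b
      have hu := envelopingRep_mem_span u
      generalize envelopingRep m u = v at hu ⊢
      induction hu using Submodule.span_induction with
      | mem x hx =>
        obtain ⟨⟨s, t⟩, rfl⟩ := hx
        have h1 := hΦ s (t.toList ++ [b])
        rw [listMonomial_append, listMonomial_cons, listMonomial_nil, mul_one, ← mul_assoc] at h1
        rw [h1, hΦ, smul_smul]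
        congr 1
        simp [mul_comm]
      | zero => simp
      | add x y _ _ hx hy => rw [add_mul, map_add, map_add, hx, hy, smul_add]
      | smul c x _ hx => rw [smul_mul_assoc, map_smul, map_smul, hx, smul_comm]
    have upper : ∀ (u : U m) (x : SL m), (∀ i j : Fin m, j < i → x.val i j = 0) →
        Φ (envelopingRep m (u * toU x)) = (∑ i, x.val i i * w i) • Φ (envelopingRep m u) := by
      intro u x hx
      rw [map_mul, envelopingRep_toU, invariantRep_eq_sum, Finset.mul_sum, map_sum,
        Finset.sum_smul]
      refine Finset.sum_congr rfl fun i _ => ?_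
      rw [Finset.mul_sum, map_sum, Finset.sum_eq_single i]
      · rw [mul_smul_comm, map_smul, show unitOp (i, i) = borelOp ⟨(i, i), le_rfl⟩ from rfl, key,
          smul_smul]
        simp [borelChar]
      · intro j _ hji
        rw [mul_smul_comm, map_smul]
        rcases lt_or_ge j i with h | h
        · rw [hx i j h, zero_smul]
        · rw [show unitOp (i, j) = borelOp ⟨(i, j), h⟩ from rfl, key]
          simp [borelChar, hji.symm]
      · simp
    have hle : ∀ x ∈ vermaIdeal lam, ∀ u : U m, Φ (envelopingRep m (u * x)) = 0 := by
      intro x hx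
      induction hx using Submodule.span_induction with
      | mem x hx =>
        intro u
        rcases hx with ⟨y, hy, rfl⟩ | ⟨h, rfl⟩
        · rw [upper u y fun i j hij => hy i j hij.le]
          simp [hy]
        · rw [mul_sub, map_sub, map_sub, upper u h.val fun i j hij => h.2 hij.ne', ← weight_eq_sum,
            Algebra.algebraMap_eq_smul_one, mul_smul_comm, mul_one, map_smul, map_smul, sub_self]
      | zero => simp
      | add x y _ _ hx hy => intro u; rw [mul_add, map_add, map_add, hx, hy, add_zero]
      | smul a x _ hx => intro u; rw [smul_eq_mul, ← mul_assoc]; exact hx _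
    intro x hx
    simpa using hle x hx 1
  · have := hΦ s []
    simpa [envelopingRep_listMonomial] using this

/-- The vectors `f^s` applied to the highest weight vector. -/
def vermaVector (lam : Module.Dual ℂ (cartan m)) (s : Multiset (NegRoot m)) : Verma lam :=
  listMonomial negU s.toList • Submodule.Quotient.mk 1

theorem linearIndependent_vermaVector (lam : Module.Dual ℂ (cartan m)) :
    LinearIndependent ℂ (vermaVector lam) := by
  obtain ⟨F, hF, hs⟩ := exists_functional_vermaIdeal lam
  rw [linearIndependent_iff]
  intro c hc
  have h1 : Finsupp.linearCombination ℂ (vermaVector lam) c = Submodule.Quotient.mk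
      (Finsupp.linearCombination ℂ (fun s => listMonomial (negU (m := m)) s.toList) c) := by
    rw [Finsupp.linearCombination_apply, Finsupp.linearCombination_apply, Finsupp.sum, Finsupp.sum,
      ← Submodule.mkQ_apply, map_sum]
    refine Finset.sum_congr rfl fun s _ => ?_
    rw [vermaVector, ← Submodule.Quotient.mk_smul, smul_eq_mul, mul_one]
    rfl
  rw [hc, eq_comm, Submodule.Quotient.mk_eq_zero] at h1
  have h2 := hF _ h1
  rw [Finsupp.linearCombination_apply, Finsupp.sum, map_sum] at h2
  rw [← h2]
  conv_lhs => rw [← Finsupp.sum_single c]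
  refine Finset.sum_congr rfl fun s _ => ?_
  rw [map_smul, hs, Finsupp.smul_single, smul_eq_mul, mul_one]

end LinearIndependence

/-! ### Spanning and the basis -/

section Spanning

variable {m : ℕ}

attribute [local instance] LieRing.ofAssociativeRing

theorem toU_add (x y : SL m) : toU (x + y) = toU x + toU y :=
  map_add (UniversalEnvelopingAlgebra.ι ℂ) x y

theorem toU_smul (c : ℂ) (x : SL m) : toU (c • x) = c • toU x :=
  map_smul (UniversalEnvelopingAlgebra.ι ℂ) c x

theorem toU_lie (x y : SL m) : toU ⁅x, y⁆ = toU x * toU y - toU y * toU x :=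
  LieHom.map_lie (UniversalEnvelopingAlgebra.ι ℂ) x y

/-- The diagonal part of a traceless matrix. -/
def diagPart (x : SL m) : cartan m :=
  ⟨⟨Matrix.diagonal fun i => x.val i i, by
    have : ∑ i, x.val i i = 0 := x.2
    change Matrix.trace (Matrix.diagonal fun i => x.val i i) = 0
    rw [Matrix.trace_diagonal, this]⟩, Matrix.isDiag_diagonal _⟩

theorem toU_smul_mk_one (lam : Module.Dual ℂ (cartan m)) {x : SL m}
    (hx : ∀ i j : Fin m, j < i → x.val i j = 0) :
    toU x • (Submodule.Quotient.mk 1 : Verma lam) =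
      lam (diagPart x) • Submodule.Quotient.mk 1 := by
  have h1 : toU (x - (diagPart x).val) ∈ vermaIdeal lam := by
    refine Submodule.subset_span (Or.inl ⟨_, fun i j hij => ?_, rfl⟩)
    change x.val i j - Matrix.diagonal (fun i => x.val i i) i j = 0
    rcases hij.lt_or_eq with h | rfl
    · rw [hx i j h, Matrix.diagonal_apply_ne _ h.ne', sub_zero]
    · rw [Matrix.diagonal_apply_eq, sub_self]
  have h2 : toU (diagPart x).val - algebraMap ℂ (U m) (lam (diagPart x)) ∈ vermaIdeal lam :=
    Submodule.subset_span (Or.inr ⟨_, rfl⟩)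
  have h3 := add_mem h1 h2
  rw [← add_sub_assoc, ← toU_add, sub_add_cancel] at h3
  rw [← Submodule.Quotient.mk_smul, ← Submodule.Quotient.mk_smul, Submodule.Quotient.eq,
    smul_eq_mul, mul_one, ← Algebra.algebraMap_eq_smul_one]
  exact h3

/-- The upper triangular traceless matrices. -/
abbrev UpperElt (m : ℕ) := {x : SL m // ∀ i j : Fin m, j < i → x.val i j = 0}

/-- Taking all upper triangular traceless matrices as generators avoids choosing a basis of the
Cartan subalgebra; redundancy is harmless for spanning. -/
theorem span_negElt_upperElt :
    Submodule.span ℂ (Set.range (Sum.elim (negElt (m := m)) (Subtype.val : UpperElt m → SL m))) =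
      ⊤ := by
  rw [eq_top_iff]
  intro x _
  set y : SL m := ∑ p : NegRoot m, x.val p.1.1 p.1.2 • negElt p with hy
  have hyv : ∀ i j, y.val i j = if j < i then x.val i j else 0 := by
    intro i j
    have h1 : y.val = ∑ p : NegRoot m, x.val p.1.1 p.1.2 •
        (Matrix.single p.1.1 p.1.2 1 : Matrix (Fin m) (Fin m) ℂ) :=
      map_sum (LieAlgebra.SpecialLinear.sl (Fin m) ℂ).toSubmodule.subtype _ _
    rw [h1, Matrix.sum_apply]
    split_ifs with h
    · rw [Finset.sum_eq_single ⟨(i, j), h⟩]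
      · simp
      · rintro ⟨⟨a, b⟩, hab⟩ _ hne
        rw [Matrix.smul_apply, Matrix.single_apply_of_ne, smul_zero]
        rintro ⟨rfl, rfl⟩
        exact hne rfl
      · simp
    · refine Finset.sum_eq_zero ?_
      rintro ⟨⟨a, b⟩, hab⟩ _
      rw [Matrix.smul_apply, Matrix.single_apply_of_ne, smul_zero]
      rintro ⟨rfl, rfl⟩
      exact h hab
  have hup : ∀ i j : Fin m, j < i → (x - y).val i j = 0 := by
    intro i j hij
    change x.val i j - y.val i j = 0
    rw [hyv, if_pos hij, sub_self]
  rw [← sub_add_cancel x y]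
  refine add_mem (Submodule.subset_span ⟨Sum.inr ⟨x - y, hup⟩, rfl⟩) ?_
  exact sum_mem fun p _ => Submodule.smul_mem _ _ (Submodule.subset_span ⟨Sum.inl p, rfl⟩)

theorem span_vermaVector (lam : Module.Dual ℂ (cartan m)) :
    Submodule.span ℂ (Set.range (vermaVector lam)) = ⊤ := by
  rw [eq_top_iff]
  rintro v -
  obtain ⟨u, rfl⟩ := Submodule.Quotient.mk_surjective _ v
  set X : NegRoot m ⊕ UpperElt m → U m := fun i => toU (Sum.elim negElt Subtype.val i) with hX
  have hgen : Algebra.adjoin ℂ (Set.range X) = ⊤ :=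
    adjoin_range_ι_comp_eq_top span_negElt_upperElt
  have hcomm : ∀ i j, X i * X j - X j * X i ∈ Submodule.span ℂ (Set.range X) := by
    intro i j
    simp only [hX, ← toU_lie]
    generalize (⁅Sum.elim negElt Subtype.val i, Sum.elim negElt Subtype.val j⁆ : SL m) = z
    have hz : z ∈ Submodule.span ℂ (Set.range
        (Sum.elim (negElt (m := m)) (Subtype.val : UpperElt m → SL m))) := by
      rw [span_negElt_upperElt]
      trivial
    induction hz using Submodule.span_induction with
    | mem a ha =>
      obtain ⟨k, rfl⟩ := ha
      exact Submodule.subset_span ⟨k, rfl⟩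
    | zero =>
      rw [show toU (0 : SL m) = 0 from map_zero (UniversalEnvelopingAlgebra.ι ℂ)]
      exact zero_mem _
    | add a b _ _ ha hb => rw [toU_add]; exact add_mem ha hb
    | smul c a _ ha => rw [toU_smul]; exact Submodule.smul_mem _ c ha
  have hu := mem_span_of_mem_adjoin hcomm
    (N := Set.range fun a : Multiset (NegRoot m) × Multiset (UpperElt m) =>
      a.1.toList.map Sum.inl ++ a.2.toList.map Sum.inr)
    (fun l => by
      obtain ⟨s, t, h⟩ := exists_perm_inl_append_inr l
      exact ⟨_, ⟨(s, t), rfl⟩, h⟩) (a := u) (hgen ▸ Algebra.mem_top)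
  -- Upper triangular factors stand on the right, next to the highest weight vector, and act on it
  -- by scalars.
  have hscal : ∀ l : List (UpperElt m), ∃ c : ℂ,
      listMonomial (fun x : UpperElt m => toU x.val) l • (Submodule.Quotient.mk 1 : Verma lam) =
        c • Submodule.Quotient.mk 1 := by
    intro l
    induction l with
    | nil => exact ⟨1, by rw [listMonomial_nil, one_smul, one_smul]⟩
    | cons x l ih =>
      obtain ⟨c, hc⟩ := ih
      refine ⟨c * lam (diagPart x.val), ?_⟩
      rw [listMonomial_cons, mul_smul, hc, smul_comm, toU_smul_mk_one lam x.2, smul_smul]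
  induction hu using Submodule.span_induction with
  | mem a ha =>
    obtain ⟨_, ⟨⟨s, t⟩, rfl⟩, rfl⟩ := ha
    obtain ⟨c, hc⟩ := hscal t.toList
    have h1 : (Submodule.Quotient.mk (listMonomial X (s.toList.map Sum.inl ++
        t.toList.map Sum.inr)) : Verma lam) = c • vermaVector lam s := by
      rw [vermaVector, ← smul_comm, ← hc, ← mul_smul, ← Submodule.Quotient.mk_smul, smul_eq_mul,
        mul_one, listMonomial_append, listMonomial_map, listMonomial_map]
      rfl
    rw [h1]
    exact Submodule.smul_mem _ _ (Submodule.subset_span ⟨s, rfl⟩)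
  | zero => exact zero_mem _
  | add a b _ _ ha hb => exact add_mem ha hb
  | smul c a _ ha => exact Submodule.smul_mem _ c ha

/-- The basis of a Verma module given by the ordered products of lower triangular matrix units. -/
def vermaBasis (lam : Module.Dual ℂ (cartan m)) :
    Module.Basis (Multiset (NegRoot m)) ℂ (Verma lam) :=
  Module.Basis.mk (linearIndependent_vermaVector lam) (span_vermaVector lam).ge

theorem vermaBasis_apply (lam : Module.Dual ℂ (cartan m)) (s : Multiset (NegRoot m)) :
    vermaBasis lam s = vermaVector lam s :=
  Module.Basis.mk_apply _ _ _

end Spanning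

/-! ### Weight spaces -/

section Weights

variable {m : ℕ}

/-- The root `ε_i - ε_j`. -/
def rootVec (p : NegRoot m) : Fin m → ℤ := Pi.single p.1.1 1 - Pi.single p.1.2 1

theorem weightOf_add (ν ν' : Fin m → ℤ) : weightOf (ν + ν') = weightOf ν + weightOf ν' := by
  ext h
  simp [weightOf, add_mul, Finset.sum_add_distrib]

theorem weightOf_zero : weightOf (0 : Fin m → ℤ) = 0 := by
  ext h
  simp [weightOf]

theorem weightOf_rootVec (p : NegRoot m) (h : cartan m) :
    weightOf (rootVec p) h = h.val.val p.1.1 p.1.1 - h.val.val p.1.2 p.1.2 := by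
  change ∑ i, ((rootVec p i : ℤ) : ℂ) * h.val.val i i = _
  simp [rootVec, Pi.single_apply, sub_mul, Finset.sum_sub_distrib]

/-- A weight `∑ ν_i e_i` with `∑ ν_i = 0` determines `ν`. -/
theorem weightOf_injective {ν ν' : Fin m → ℤ} (hν : ∑ i, ν i = 0) (hν' : ∑ i, ν' i = 0)
    (h : (weightOf ν : Module.Dual ℂ (cartan m)) = weightOf ν') : ν = ν' := by
  have hc : ∀ (α : Fin m → ℤ) (i j : Fin m),
      (weightOf α : Module.Dual ℂ (cartan m)) (coroot m i j) = ((α i - α j : ℤ) : ℂ) := by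
    intro α i j
    change ∑ l, (α l : ℂ) *
      (Matrix.single i i (1 : ℂ) - Matrix.single j j 1 : Matrix (Fin m) (Fin m) ℂ) l l = _
    simp [Matrix.single_apply, mul_sub, Finset.sum_sub_distrib]
  have hd : ∀ i j, ν i - ν j = ν' i - ν' j := fun i j => by
    have := DFunLike.congr_fun h (coroot m i j)
    rw [hc, hc] at this
    exact_mod_cast this
  funext i
  -- Coroots see only differences; since the totals vanish, summing over `j` leaves `m * ν i`, and
  -- `m ≠ 0` because `i` exists.
  have h1 : ∑ j, (ν i - ν j) = ∑ j, (ν' i - ν' j) := Finset.sum_congr rfl fun j _ => hd i j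
  simp only [Finset.sum_sub_distrib, hν, hν', Finset.sum_const, Finset.card_univ, Fintype.card_fin,
    nsmul_eq_mul, sub_zero] at h1
  exact mul_left_cancel₀ (Nat.cast_ne_zero.mpr i.pos.ne') h1

theorem lie_negElt (h : cartan m) (p : NegRoot m) :
    ⁅h.val, negElt p⁆ = weightOf (rootVec p) h • negElt p := by
  rw [weightOf_rootVec]
  apply Subtype.ext
  obtain ⟨⟨i, j⟩, hij⟩ := p
  have hd : h.val.val = Matrix.diagonal fun i => h.val.val i i :=
    ((Matrix.isDiag_iff_diagonal_diag _).mp h.2).symm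
  rw [LieAlgebra.SpecialLinear.sl_bracket]
  change h.val.val * Matrix.single i j 1 - Matrix.single i j 1 * h.val.val =
    (h.val.val i i - h.val.val j j) • Matrix.single i j (1 : ℂ)
  ext a b
  rw [Matrix.sub_apply, hd, Matrix.diagonal_mul, Matrix.mul_diagonal, Matrix.smul_apply]
  simp only [Matrix.single_apply, Matrix.diagonal_apply_eq]
  split_ifs with hab
  · rw [← hab.1, ← hab.2]
    simp
  · simp

/-- The vector `∑_{p ∈ s} (ε_i - ε_j)`. -/
def multisetWeight (s : Multiset (NegRoot m)) : Fin m → ℤ := (s.map rootVec).sum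

theorem toU_smul_vermaVector (lam : Module.Dual ℂ (cartan m)) (s : Multiset (NegRoot m))
    (h : cartan m) :
    toU h.val • vermaVector lam s = (lam + weightOf (multisetWeight s)) h • vermaVector lam s := by
  have key : ∀ l : List (NegRoot m), toU h.val • listMonomial negU l •
      (Submodule.Quotient.mk 1 : Verma lam) = (lam + weightOf (l.map rootVec).sum) h •
        listMonomial negU l • Submodule.Quotient.mk 1 := by
    intro l
    induction l with
    | nil =>
      rw [listMonomial_nil, one_smul, toU_smul_mk_one lam fun i j hij => h.2 hij.ne', List.map_nil,
        List.sum_nil, weightOf_zero, add_zero]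
      congr 2
      apply Subtype.ext
      apply Subtype.ext
      exact (Matrix.isDiag_iff_diagonal_diag _).mp h.2
    | cons p l ih =>
      have hcomm : toU h.val * negU p = negU p * toU h.val + weightOf (rootVec p) h • negU p := by
        rw [negU, ← toU_smul, ← lie_negElt, toU_lie]
        abel
      rw [listMonomial_cons, mul_smul, ← mul_smul (toU h.val), hcomm, add_smul, mul_smul, ih,
        smul_comm (negU p), smul_assoc, ← add_smul, List.map_cons, List.sum_cons, weightOf_add]
      congr 1
      simp only [LinearMap.add_apply]
      ring
  rw [vermaVector, key]
  congr 4
  rw [multisetWeight, ← Multiset.sum_coe, ← Multiset.map_coe, Multiset.coe_toList]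

/-- The Cartan subalgebra acts diagonally on `vermaBasis`, so comparing coordinates shows that only
basis vectors of weight `μ` occur. -/
theorem weightSpace_eq_span (lam μ : Module.Dual ℂ (cartan m)) :
    weightSpace lam μ = Submodule.span ℂ (Set.range fun s :
      {s : Multiset (NegRoot m) // lam + weightOf (multisetWeight s) = μ} =>
        vermaVector lam s.1) := by
  apply le_antisymm
  · intro v hv
    have hv' : ∀ h : cartan m, toU h.val • v = μ h • v := hv
    rw [← (vermaBasis lam).linearCombination_repr v, Finsupp.linearCombination_apply]
    refine sum_mem fun s hs => Submodule.smul_mem _ _ (Submodule.subset_span ⟨⟨s, ?_⟩, ?_⟩)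
    · ext h
      have hcoef : ∀ v : Verma lam, (vermaBasis lam).repr (toU h.val • v) s =
          (lam + weightOf (multisetWeight s)) h * (vermaBasis lam).repr v s := by
        intro v
        have hv : v ∈ Submodule.span ℂ (Set.range (vermaVector lam)) := by
          rw [span_vermaVector]
          trivial
        induction hv using Submodule.span_induction with
        | zero => simp
        | mem a ha =>
          obtain ⟨t, rfl⟩ := ha
          rw [toU_smul_vermaVector, ← vermaBasis_apply, map_smul,
            Finsupp.smul_apply, smul_eq_mul, Module.Basis.repr_self]
          by_cases hts : t = s
          · rw [hts]
          · rw [Finsupp.single_eq_of_ne (Ne.symm hts), mul_zero, mul_zero]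
        | add a b _ _ ha hb => rw [smul_add, map_add, map_add, Finsupp.add_apply, Finsupp.add_apply,
            ha, hb, mul_add]
        | smul c a _ ha => rw [smul_comm (toU h.val) c a, map_smul, map_smul _ c a,
            Finsupp.smul_apply, Finsupp.smul_apply, ha, smul_eq_mul, smul_eq_mul, mul_left_comm]
      have h1 := hcoef v
      rw [hv', map_smul, Finsupp.smul_apply, smul_eq_mul] at h1
      exact (mul_right_cancel₀ (Finsupp.mem_support_iff.mp hs) h1).symm
    · exact (vermaBasis_apply lam s).symm
  · rw [Submodule.span_le]
    rintro _ ⟨⟨s, rfl⟩, rfl⟩ h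
    exact toU_smul_vermaVector lam s h

theorem rootSum_count (s : Multiset (NegRoot m)) :
    rootSum m (fun p => s.count p) = multisetWeight s := by
  rw [rootSum_apply, multisetWeight, Finset.sum_multiset_map_count]
  symm
  refine Finset.sum_subset (Finset.subset_univ _) fun p _ hp => ?_
  rw [Multiset.count_eq_zero.mpr (by simpa using hp), zero_smul]

/-- Multisets of negative roots as families of multiplicities. -/
def countEquiv : Multiset (NegRoot m) ≃ (NegRoot m → ℕ) :=
  Multiset.toFinsupp.toEquiv.trans Finsupp.equivFunOnFinite

theorem rootSum_countEquiv (s : Multiset (NegRoot m)) :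
    rootSum m (countEquiv s) = multisetWeight s := by
  rw [← rootSum_count]
  congr 1

theorem sum_multisetWeight (s : Multiset (NegRoot m)) : ∑ i, multisetWeight s i = 0 := by
  rw [← rootSum_countEquiv, sum_rootSum]

theorem exists_of_weightSpace_ne_bot {lam μ : Module.Dual ℂ (cartan m)}
    (h : weightSpace lam μ ≠ ⊥) : ∃ s, lam + weightOf (multisetWeight s) = μ := by
  by_contra! hs
  refine h ?_
  rw [weightSpace_eq_span, Submodule.span_eq_bot]
  rintro _ ⟨⟨s, hs'⟩, rfl⟩
  exact absurd hs' (hs s)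

/-- The index set of a weight space in terms of families of multiplicities. -/
def weightIndexEquiv (lam : Module.Dual ℂ (cartan m)) {ν : Fin m → ℤ} (hν : ∑ i, ν i = 0) :
    {s : Multiset (NegRoot m) // lam + weightOf (multisetWeight s) = lam + weightOf ν} ≃
      {k // rootSum m k = ν} :=
  countEquiv.subtypeEquiv fun s => by
    rw [rootSum_countEquiv, add_right_inj]
    exact ⟨weightOf_injective (sum_multisetWeight s) hν, fun h => by rw [h]⟩

theorem finiteDimensional_weightSpace (lam μ : Module.Dual ℂ (cartan m)) :
    FiniteDimensional ℂ (weightSpace lam μ) := by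
  by_cases h : weightSpace lam μ = ⊥
  · rw [h]; infer_instance
  · obtain ⟨s, rfl⟩ := exists_of_weightSpace_ne_bot h
    have := Finite.of_equiv _ (weightIndexEquiv lam (sum_multisetWeight s)).symm
    rw [weightSpace_eq_span]
    exact FiniteDimensional.span_of_finite ℂ (Set.finite_range _)

theorem finrank_weightSpace (lam : Module.Dual ℂ (cartan m)) {ν : Fin m → ℤ}
    (hν : ∑ i, ν i = 0) :
    Module.finrank ℂ (weightSpace lam (lam + weightOf ν)) =
      Nat.card {k // rootSum m k = ν} := by
  rw [weightSpace_eq_span, ← Nat.card_congr (weightIndexEquiv lam hν)]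
  exact Module.finrank_eq_nat_card_basis (Module.Basis.span
    ((linearIndependent_vermaVector lam).comp _ Subtype.val_injective))

theorem shiftedCharacter_eq (lam : Module.Dual ℂ (cartan m)) :
    shiftedCharacter lam = geometricProduct m := by
  funext ν
  rw [shiftedCharacter]
  split_ifs with hν
  · rw [finrank_weightSpace lam hν, geometricProduct_eq_card]
  · symm
    by_contra h
    obtain ⟨k, rfl⟩ := (geometricProduct_ne_zero_iff ν).mp h
    exact hν (sum_rootSum k)

end Weights

end VermaLorentzian

end

theorem mainTheorem8 (m : ℕ) (lam : Module.Dual ℂ (VermaLorentzian.cartan m))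
    (hlam : lam ∈ VermaLorentzian.weightLattice m) :
    (∀ μ ∈ VermaLorentzian.weightLattice m,
      FiniteDimensional ℂ (VermaLorentzian.weightSpace lam μ) ∧
      (VermaLorentzian.weightSpace lam μ ≠ ⊥ →
        ∃ ν : Fin m → ℤ, ∑ i, ν i = 0 ∧ μ = lam + VermaLorentzian.weightOf ν)) ∧
    VermaLorentzian.shiftedCharacter lam = VermaLorentzian.geometricProduct m ∧
    ∀ δ : Fin m → ℕ, ∃ p : MvPolynomial (Fin m) ℝ,
      (p : MvPowerSeries (Fin m) ℝ) =
        ((VermaLorentzian.shiftedCharacter lam).monomialMul δ).normalize ∧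
      VermaLorentzian.IsLorentzian p := by
  refine ⟨fun μ _ => ⟨VermaLorentzian.finiteDimensional_weightSpace lam μ, fun h => ?_⟩,
    VermaLorentzian.shiftedCharacter_eq lam, fun δ => ?_⟩
  · obtain ⟨s, hs⟩ := VermaLorentzian.exists_of_weightSpace_ne_bot h
    exact ⟨_, VermaLorentzian.sum_multisetWeight s, hs.symm⟩
  · rw [VermaLorentzian.shiftedCharacter_eq]
    exact VermaLorentzian.exists_isLorentzian_normalize δ
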